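/- **Notation.** For $\mathrm{Im}\,\tau>0$ let $\theta(z,\tau)=-\sum_{n\in\mathbb Z+1/2}e^{\pi i(n^2\tau+n(2z+1))}$, with $\theta'$ its derivative in $z$. For $\mathrm{Im}\,\tau,\mathrm{Im}\,\sigma>0$ let $$\Omega_{a}(t,\tau,\sigma)=\prod_{j,k=0}^\infty\frac{(1-e^{2\pi i(t-a+j\tau+k\sigma)})(1-e^{2\pi i(-t-a+(j+1)\tau+(k+1)\sigma)})}{(1-e^{2\pi i(t+a+j\tau+k\sigma)})(1-e^{2\pi i(-t+a+(j+1)\tau+(k+1)\sigma)})}.$$ For $\mathrm{Im}\,\eta>0$ put $$u(\lambda,\mu,\tau,\sigma,\eta)=e^{-\frac{\pi i\lambda\mu}{2\eta}}\int_0^1\Omega_{2\eta}(t,\tau,\sigma)\frac{\theta(\lambda+t,\tau)\,\theta(\mu+t,\sigma)}{\theta(t-2\eta,\tau)\,\theta(t-2\eta,\sigma)}\,dt,$$ and for general $\eta$ define $u$ by analytic continuation in $\eta$ to the complement of the points with $4\eta+l+m\tau+n\sigma=0$, $l\in\mathbb Z$, $m,n\in\mathbb Z_{\ge0}$. Let $$Q(\mu,\sigma,\eta)=\frac{\theta(4\eta,\sigma)\,\theta'(0,\sigma)}{\theta(\mu-2\eta,\sigma)\,\theta(\mu+2\eta,\sigma)}.$$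 For an integer $\kappa\ge4$, call $l\in\mathbb Z$ admissible if $l\not\equiv\pm1 \pmod\kappa$, and for such $l$ put $$\widetilde\Delta_{l,\kappa}(\lambda,\tau,\eta)=\sum_{j\in2\kappa\mathbb Z+l}u(\lambda,2\eta j,\tau,-2\eta\kappa,\eta)\,Q(2\eta j,-2\eta\kappa,\eta)\,e^{\pi i\frac{\tau+4\eta}{2\kappa}j^2},$$ $$\Delta_{l,\kappa}(\lambda,\tau,\eta)=\widetilde\Delta_{l,\kappa}(\lambda,\tau,\eta)-\widetilde\Delta_{l,\kappa}(-\lambda,\tau,\eta).$$ **Theorem 4.2.** Let $\kappa\ge4$ be an integer, $\mathrm{Im}\,\tau>0$, $\mathrm{Im}\,\eta<0$, and $j\tau+4\eta\notin\mathbb Z$ for every $j=1,2,\dots$. Let $l$ be admissible. Then the functions above are well defined (the analytic continuation of $u(\lambda,\mu,\tau,-2\eta\kappa,\cdot)$ exists for all $\lambda,\mu\in\mathbb C$, and the series $\widetilde\Delta_{l,\kappa}(\lambda,\tau,\eta)$ converges absolutely for every $\lambda\in\mathbb C$), and for all $\lambda\in\mathbb C$ $$\Delta_{l,\kappa}(\lambda+1,\tau,\eta)=(-1)^{l+1}\Delta_{l,\kappa}(\lambda,\tau,\eta),$$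 $$e^{\pi i(\kappa+2)(\lambda+\tau/2)}\,\Delta_{l,\kappa}(\lambda+\tau,\tau,\eta)=\Delta_{l+\kappa,\kappa}(\lambda,\tau,\eta).$$ -/

import Mathlib

noncomputable section

namespace HypergeometricTheta

open Complex

/-- Jacobi's first theta function
`θ(z, τ) = -∑_{m ∈ ℤ + 1/2} exp (π i (m² τ + m (2 z + 1)))`, with `m = n + 1/2`. -/
def theta (z τ : ℂ) : ℂ :=
  -∑' n : ℤ, cexp (Real.pi * I * (((n : ℂ) + 1 / 2) ^ 2 * τ + ((n : ℂ) + 1 / 2) * (2 * z + 1)))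

/-- The phase function `Ω_a(t, τ, σ)`, a double infinite product over `j, k ≥ 0`. -/
def Omega (a t τ σ : ℂ) : ℂ :=
  ∏' p : ℕ × ℕ,
    ((1 - cexp (2 * Real.pi * I * (t - a + p.1 * τ + p.2 * σ))) *
        (1 - cexp (2 * Real.pi * I * (-t - a + (p.1 + 1) * τ + (p.2 + 1) * σ)))) /
      ((1 - cexp (2 * Real.pi * I * (t + a + p.1 * τ + p.2 * σ))) *
        (1 - cexp (2 * Real.pi * I * (-t + a + (p.1 + 1) * τ + (p.2 + 1) * σ))))

/-- The hypergeometric integral over the interval `[0, 1]`; this is the function `u` for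
`Im η > 0`. -/
def uIntegral (lam μ τ σ η : ℂ) : ℂ :=
  cexp (-(Real.pi * I * lam * μ / (2 * η))) *
    ∫ t in (0 : ℝ)..1,
      Omega (2 * η) t τ σ * (theta (lam + t) τ * theta (μ + t) σ /
        (theta (t - 2 * η) τ * theta (t - 2 * η) σ))

/-- The values of `η` off the polar hyperplanes `4 η + l + m τ + n σ = 0`, `l ∈ ℤ`, `m, n ≥ 0`.
For `τ, σ` in the upper half plane this is the complement of a closed discrete set (so it is open
and connected), and it contains the upper half plane. -/
def regularSet (τ σ : ℂ) : Set ℂ :=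
  {η | ∀ (l : ℤ) (m n : ℕ), 4 * η + l + m * τ + n * σ ≠ 0}

/-- `f` is the analytic continuation in `η` of the hypergeometric integral (given by the integral
over `[0, 1]` for `Im η > 0`) to the complement of the polar hyperplanes. As this complement is
connected, `f` is uniquely determined there. -/
def IsContinuation (lam μ τ σ : ℂ) (f : ℂ → ℂ) : Prop :=
  AnalyticOnNhd ℂ f (regularSet τ σ) ∧ ∀ η : ℂ, 0 < η.im → f η = uIntegral lam μ τ σ η

/-- The hypergeometric integral `u(lam, μ, τ, σ, η)`, for `τ, σ` in the upper half plane and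
`η ∈ regularSet τ σ`: the value at `η` of the analytic continuation. -/
def u (lam μ τ σ η : ℂ) : ℂ :=
  Classical.epsilon (fun f : ℂ → ℂ => IsContinuation lam μ τ σ f) η

/-- `Q(μ, σ, η) = θ(4η, σ) θ'(0, σ) / (θ(μ - 2η, σ) θ(μ + 2η, σ))`, the prime denoting the
derivative in the first argument. -/
def Q (μ σ η : ℂ) : ℂ :=
  theta (4 * η) σ * deriv (fun z => theta z σ) 0 / (theta (μ - 2 * η) σ * theta (μ + 2 * η) σ)

/-- `l` is admissible with respect to `κ`: `l ≢ ± 1 mod κ`. -/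
def Admissible (κ l : ℤ) : Prop :=
  ¬ l ≡ 1 [ZMOD κ] ∧ ¬ l ≡ -1 [ZMOD κ]

/-- The summand with index `j` in the non-symmetric hypergeometric theta function of
level `κ + 2`. -/
def summand (κ : ℤ) (lam τ η : ℂ) (j : ℤ) : ℂ :=
  u lam (2 * η * j) τ (-2 * η * κ) η * Q (2 * η * j) (-2 * η * κ) η *
    cexp (Real.pi * I * ((τ + 4 * η) / (2 * κ)) * (j : ℂ) ^ 2)

/-- The `l`-th non-symmetric hypergeometric theta function of level `κ + 2`: the sum of the
summands with index `j ∈ 2 κ ℤ + l`. -/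
def DeltaTilde (l κ : ℤ) (lam τ η : ℂ) : ℂ :=
  ∑' n : ℤ, summand κ lam τ η (2 * κ * n + l)

/-- The `l`-th hypergeometric theta function of level `κ + 2`. -/
def Delta (l κ : ℤ) (lam τ η : ℂ) : ℂ :=
  DeltaTilde l κ lam τ η - DeltaTilde l κ (-lam) τ η

end HypergeometricTheta

end

/-! Both identities hold term by term. With σ = -2ηκ and μ = 2ηj, the shift μ → μ + σ is j → j - κ.
In the integrand, θ(λ + τ + t, τ) θ(μ + t, σ) and θ(λ + t, τ) θ(μ + σ + t, σ) differ by a factor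
free of t, so u(λ + τ, μ) is an explicit exponential times u(λ, μ + σ). Together with the
multipliers of Q and of the Gaussian, every dependence on j cancels: the j-th summand at λ + τ,
times the prefactor, is the (j - κ)-th summand at λ (`summand_add_tau`). The shift λ → λ + 1
contributes (-1)^(j+1) (`summand_add_one`).

The work lies in making sense of u for Im η < 0. By the triple product, the quotient of Ω by the two
theta functions is a constant times a kernel symmetric under t → -t (`exists_Omega_div_theta_eq`),
with poles where e(±t + 2η + jτ + kσ) = 1. A pole from each family can pinch the contour only when
4η + mτ + nσ is an integer, which is exactly what the regular set excludes. Instead of deforming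
contours, finitely many dangerous factors are separated by partial fractions; this creates
denominators 1 - ab with ab = e(4η + mτ + nσ), and leaves integrals over Im t = ±R without poles on
them (`splitIntegral`, `exists_continuation_halfPlane`).

The outcome is used as a functional of the numerator (`exists_functional`). One J serves all λ and μ
and is homogeneous, so theta identities pass to the continued u directly. It is bounded by values on
two segments, so it grows at most exponentially in the summation index, and the Gaussian with Im τ >
0 makes the series converge (`summable_summand`). -/

noncomputable section

namespace HypergeometricTheta

open Complex

/-! ### Infinite products of factors 1 - e(x + c): convergence, zeros, functional equations. -/

section

/-- The exponential `e^{2πiz}`. -/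
def expTwoPi (z : ℂ) : ℂ := cexp (2 * Real.pi * I * z)

lemma expTwoPi_add (x y : ℂ) : expTwoPi (x + y) = expTwoPi x * expTwoPi y := by
  simp only [expTwoPi, mul_add, Complex.exp_add]

lemma expTwoPi_neg (x : ℂ) : expTwoPi (-x) = (expTwoPi x)⁻¹ := by
  simp only [expTwoPi, mul_neg, Complex.exp_neg]

lemma expTwoPi_ne_zero (x : ℂ) : expTwoPi x ≠ 0 := Complex.exp_ne_zero _

@[simp] lemma expTwoPi_zero : expTwoPi 0 = 1 := by simp [expTwoPi]

lemma expTwoPi_eq_one_iff (x : ℂ) : expTwoPi x = 1 ↔ ∃ n : ℤ, x = n := by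
  rw [expTwoPi, Complex.exp_eq_one_iff]
  have : (2 * Real.pi * I : ℂ) ≠ 0 := by simp [Real.pi_ne_zero]
  refine exists_congr fun n => ?_
  rw [mul_comm (n : ℂ)]
  exact mul_right_inj' this

@[simp] lemma expTwoPi_intCast (n : ℤ) : expTwoPi n = 1 := (expTwoPi_eq_one_iff _).2 ⟨n, rfl⟩

@[simp] lemma expTwoPi_one : expTwoPi 1 = 1 := by simpa using expTwoPi_intCast 1

lemma expTwoPi_intMul (n : ℤ) (x : ℂ) : expTwoPi (n * x) = expTwoPi x ^ n := by
  rw [expTwoPi, expTwoPi, ← Complex.exp_int_mul]; congr 1; ring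

lemma norm_expTwoPi (z : ℂ) : ‖expTwoPi z‖ = Real.exp (-(2 * Real.pi * z.im)) := by
  rw [expTwoPi, Complex.norm_exp]
  congr 1
  simp

lemma norm_expTwoPi_lt_one {z : ℂ} (hz : 0 < z.im) : ‖expTwoPi z‖ < 1 := by
  rw [norm_expTwoPi, Real.exp_lt_one_iff]
  have := Real.pi_pos
  have : 0 < 2 * Real.pi * z.im := by positivity
  linarith

lemma one_sub_expTwoPi_ne_zero {z : ℂ} (hz : 0 < z.im) : 1 - expTwoPi z ≠ 0 := by
  intro h
  have := norm_expTwoPi_lt_one hz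
  rw [← sub_eq_zero.1 h] at this
  simp at this

@[fun_prop] lemma differentiable_expTwoPi : Differentiable ℂ expTwoPi := by
  unfold expTwoPi; fun_prop

@[fun_prop] lemma continuous_expTwoPi : Continuous expTwoPi :=
  differentiable_expTwoPi.continuous

/-- The product of the factors `1 - e^{2πi(x + c_i)}`. -/
def expProd {ι : Type*} (c : ι → ℂ) (x : ℂ) : ℂ := ∏' i, (1 - expTwoPi (x + c i))

section expProd

variable {ι ι₁ ι₂ : Type*} {c : ι → ℂ}

lemma summable_norm_neg_expTwoPi_add (hc : Summable fun i => ‖expTwoPi (c i)‖) (x : ℂ) :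
    Summable fun i => ‖-expTwoPi (x + c i)‖ := by
  simp only [norm_neg, expTwoPi_add, norm_mul]
  exact hc.mul_left _

lemma multipliable_expProd (hc : Summable fun i => ‖expTwoPi (c i)‖) (x : ℂ) :
    Multipliable fun i => 1 - expTwoPi (x + c i) := by
  simp only [sub_eq_add_neg]
  exact multipliable_one_add_of_summable (summable_norm_neg_expTwoPi_add hc x)

/-- An absolutely convergent product vanishes only through one of its factors. -/
lemma expProd_eq_zero_iff (hc : Summable fun i => ‖expTwoPi (c i)‖) (x : ℂ) :
    expProd c x = 0 ↔ ∃ i, expTwoPi (x + c i) = 1 := by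
  constructor
  · intro h
    by_contra! hne
    refine tprod_one_add_ne_zero_of_summable (f := fun i => -expTwoPi (x + c i)) (fun i => ?_)
      (summable_norm_neg_expTwoPi_add hc x) ?_
    · rw [← sub_eq_add_neg, sub_ne_zero]; exact (hne i).symm
    · simpa only [← sub_eq_add_neg, expProd] using h
  · rintro ⟨i, hi⟩
    exact tprod_of_exists_eq_zero ⟨i, by rw [hi, sub_self]⟩

lemma expProd_ne_zero (hc : Summable fun i => ‖expTwoPi (c i)‖) {x : ℂ}
    (hx : ∀ i, 0 < (x + c i).im) : expProd c x ≠ 0 := by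
  rw [Ne, expProd_eq_zero_iff hc]
  rintro ⟨i, hi⟩
  exact one_sub_expTwoPi_ne_zero (hx i) (sub_eq_zero.2 hi.symm)

lemma expProd_add_one (c : ι → ℂ) (x : ℂ) : expProd c (x + 1) = expProd c x := by
  refine tprod_congr fun i => ?_
  rw [add_right_comm, expTwoPi_add, expTwoPi_one, mul_one]

lemma differentiable_expProd (hc : Summable fun i => ‖expTwoPi (c i)‖) :
    Differentiable ℂ (expProd c) := by
  intro x
  -- On this half plane around x, e(z) is bounded, so summability of e(c i) gives a uniform majorant
  -- for all factors.
  set K : Set ℂ := {z | x.im - 1 < z.im} with hK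
  have hKo : IsOpen K := isOpen_lt continuous_const Complex.continuous_im
  have key : HasProdLocallyUniformlyOn (fun i z => 1 + -expTwoPi (z + c i))
      (fun z => ∏' i, (1 + -expTwoPi (z + c i))) K := by
    refine Summable.hasProdLocallyUniformlyOn_one_add hKo
      (hc.mul_left (Real.exp (-(2 * Real.pi * (x.im - 1))))) (Filter.Eventually.of_forall ?_)
      (fun i => by fun_prop)
    intro i z hz
    rw [norm_neg, expTwoPi_add, norm_mul]
    gcongr
    rw [norm_expTwoPi]
    gcongr
    exact le_of_lt hz
  have hd : DifferentiableOn ℂ (fun z => ∏' i, (1 + -expTwoPi (z + c i))) K := by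
    refine TendstoLocallyUniformlyOn.differentiableOn
      (hasProdLocallyUniformlyOn_iff_tendstoLocallyUniformlyOn.1 key)
      (.of_forall fun s => ?_) hKo
    exact DifferentiableOn.fun_finsetProd fun i _ => by fun_prop
  have := hd.differentiableAt (hKo.mem_nhds (show x ∈ K by simp [hK]))
  simpa only [← sub_eq_add_neg] using! this

/-- Every functional equation below comes from splitting the index set in two; taking the pieces as
ranges of injections lets each be reindexed at once. -/
lemma expProd_mul_of_range_eq_compl (hc : Summable fun i => ‖expTwoPi (c i)‖) {f : ι₁ → ι}
    {g : ι₂ → ι} (hf : Function.Injective f) (hg : Function.Injective g)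
    (hfg : Set.range g = (Set.range f)ᶜ) (x : ℂ) :
    expProd c x = expProd (fun i => c (f i)) x * expProd (fun i => c (g i)) x := by
  have h1 : HasProd (fun i => 1 - expTwoPi (x + c (f i))) (expProd (fun i => c (f i)) x) :=
    (multipliable_expProd (hc.comp_injective hf) x).hasProd
  have h2 : HasProd (fun i => 1 - expTwoPi (x + c (g i))) (expProd (fun i => c (g i)) x) :=
    (multipliable_expProd (hc.comp_injective hg) x).hasProd
  have h1' := (hf.hasProd_range_iff (f := fun i => 1 - expTwoPi (x + c i))).2 h1
  have h2' := (hg.hasProd_range_iff (f := fun i => 1 - expTwoPi (x + c i))).2 h2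
  rw [hfg] at h2'
  exact (HasProd.mul_compl (f := fun i => 1 - expTwoPi (x + c i)) h1' h2').tprod_eq

lemma expProd_finset_mul_compl (hc : Summable fun i => ‖expTwoPi (c i)‖) (S : Finset ι) (x : ℂ) :
    expProd c x = (∏ i ∈ S, (1 - expTwoPi (x + c i))) *
      expProd (fun i : {i // i ∉ S} => c i) x := by
  rw [expProd_mul_of_range_eq_compl hc (f := ((↑) : S → ι)) (g := ((↑) : {i // i ∉ S} → ι))
    Subtype.val_injective Subtype.val_injective]
  · congr 1
    rw [expProd, tprod_fintype]
    exact Finset.prod_coe_sort S (fun i => 1 - expTwoPi (x + c i))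
  · ext; simp

end expProd

/-- The exponents `j τ` of the `q`-Pochhammer symbol. -/
def pochShift (τ : ℂ) (j : ℕ) : ℂ := j * τ

/-- The exponents `j τ + k σ` of the double `q`-Pochhammer symbol. -/
def dblShift (τ σ : ℂ) (p : ℕ × ℕ) : ℂ := p.1 * τ + p.2 * σ

variable {τ σ : ℂ}

lemma summable_pochShift (hτ : 0 < τ.im) : Summable fun j => ‖expTwoPi (pochShift τ j)‖ := by
  have : ∀ j : ℕ, ‖expTwoPi (pochShift τ j)‖ = ‖expTwoPi τ‖ ^ j := fun j => by
    have := expTwoPi_intMul j τ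
    rw [pochShift, ← norm_pow]
    exact_mod_cast congrArg norm this
  simp only [this]
  exact summable_geometric_of_lt_one (norm_nonneg _) (norm_expTwoPi_lt_one hτ)

lemma summable_dblShift (hτ : 0 < τ.im) (hσ : 0 < σ.im) :
    Summable fun p => ‖expTwoPi (dblShift τ σ p)‖ := by
  simp only [dblShift, expTwoPi_add, norm_mul]
  exact (summable_pochShift hτ).mul_of_nonneg (summable_pochShift hσ)
    (fun _ => norm_nonneg _) (fun _ => norm_nonneg _)

/-- The `q`-Pochhammer symbol is the first factor times the shifted symbol. -/
lemma expProd_pochShift (hτ : 0 < τ.im) (x : ℂ) :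
    expProd (pochShift τ) x = (1 - expTwoPi x) * expProd (pochShift τ) (x + τ) := by
  rw [expProd_mul_of_range_eq_compl (summable_pochShift hτ) (f := fun _ : Unit => 0) (g := Nat.succ)
    (fun _ _ _ => rfl) Nat.succ_injective]
  · congr 1
    · simp [expProd, pochShift]
    · refine tprod_congr fun j => ?_
      simp only [pochShift]
      push_cast
      ring_nf
  · rw [Set.range_const, Nat.range_succ]
    ext; simp [Nat.pos_iff_ne_zero]

lemma expProd_dblShift_right (hτ : 0 < τ.im) (hσ : 0 < σ.im) (x : ℂ) :
    expProd (dblShift τ σ) x = expProd (pochShift τ) x * expProd (dblShift τ σ) (x + σ) := by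
  rw [expProd_mul_of_range_eq_compl (summable_dblShift hτ hσ) (f := fun j : ℕ => (j, 0))
    (g := fun p : ℕ × ℕ => (p.1, p.2 + 1)) (fun _ _ h => by simpa using h)
    (fun _ _ h => by simpa [Prod.ext_iff] using h)]
  · congr 1
    · refine tprod_congr fun j => ?_
      simp [pochShift, dblShift]
    · refine tprod_congr fun j => ?_
      simp only [dblShift]
      push_cast
      ring_nf
  · ext ⟨a, b⟩
    rcases b with _ | b <;> simp

lemma expProd_dblShift_swap (x : ℂ) : expProd (dblShift τ σ) x = expProd (dblShift σ τ) x := by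
  rw [expProd, ← (Equiv.prodComm ℕ ℕ).tprod_eq]
  refine tprod_congr fun p => ?_
  simp [dblShift, add_comm]

lemma expProd_dblShift_left (hτ : 0 < τ.im) (hσ : 0 < σ.im) (x : ℂ) :
    expProd (dblShift τ σ) x = expProd (pochShift σ) x * expProd (dblShift τ σ) (x + τ) := by
  rw [expProd_dblShift_swap, expProd_dblShift_right hσ hτ, expProd_dblShift_swap (x := x + τ)]

end

/-! ### Shifting contours, Fourier uniqueness and the triple product. -/

section

/-- Cauchy's theorem on a rectangle of width 1, whose vertical sides cancel by periodicity; real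
shifts are handled by periodicity alone. -/
lemma integral_horizontal_eq_of_periodic {F : ℂ → ℂ} (hF : ∀ z, F (z + 1) = F z) {c d : ℂ}
    (hd : ∀ z : ℂ, z.im ∈ Set.uIcc c.im d.im → DifferentiableAt ℂ F z) :
    ∫ x in (0 : ℝ)..1, F (x + c) = ∫ x in (0 : ℝ)..1, F (x + d) := by
  have real_shift : ∀ (r y : ℝ), ∫ x in (0 : ℝ)..1, F (x + (r + y * I)) =
      ∫ x in (0 : ℝ)..1, F (x + y * I) := fun r y => by
    have hper : Function.Periodic (fun x : ℝ => F (x + y * I)) 1 := fun x => by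
      simpa [add_right_comm] using hF (x + y * I)
    have h := hper.intervalIntegral_add_eq r 0
    rw [zero_add] at h
    rw [← h]
    have := intervalIntegral.integral_comp_add_right (a := 0) (b := 1)
      (fun x : ℝ => F (x + y * I)) r
    rw [zero_add, add_comm 1 r] at this
    rw [← this]
    refine intervalIntegral.integral_congr fun x _ => ?_
    push_cast; ring_nf
  rw [← Complex.re_add_im c, ← Complex.re_add_im d, real_shift, real_shift]
  have h := integral_boundary_rect_eq_zero_of_differentiableOn F (c.im * I) (1 + d.im * I)
    (fun z hz => (hd z ?_).differentiableWithinAt)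
  · simp only [mul_re, ofReal_re, I_re, mul_zero, ofReal_im, I_im, mul_one, sub_self, add_re,
      one_re, add_zero, mul_im, add_im, one_im, zero_add, ofReal_zero, ofReal_one] at h
    have h2 : ∫ y in c.im..d.im, F (1 + y * I) = ∫ y in c.im..d.im, F (y * I) :=
      intervalIntegral.integral_congr fun y _ => by rw [← hF (y * I), add_comm]
    rw [h2, add_sub_cancel_right] at h
    exact sub_eq_zero.1 h
  · simpa using (Complex.mem_reProdIm.1 hz).2


/-- A continuous `1`-periodic function on the line with vanishing Fourier coefficients is zero. -/
lemma eq_zero_of_fourier_integral_eq_zero {f : ℝ → ℂ} (hf : Continuous f)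
    (hper : Function.Periodic f 1)
    (h : ∀ n : ℤ, ∫ x in (0 : ℝ)..1, expTwoPi (n * x) * f x = 0) (x : ℝ) : f x = 0 := by
  have : Fact ((0 : ℝ) < 1) := ⟨one_pos⟩
  let g : C(AddCircle (1 : ℝ), ℂ) := ⟨hper.lift, continuous_coinduced_dom.mpr hf⟩
  have hg : ∀ x : ℝ, g (x : AddCircle (1 : ℝ)) = f x := fun x => hper.lift_coe x
  have hc : fourierCoeff g = 0 := by
    funext n
    rw [fourierCoeff_eq_intervalIntegral g n 0, zero_add]
    have := h (-n)
    simp only [Pi.zero_apply, smul_eq_mul, hg, fourier_coe_apply]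
    rw [smul_eq_zero]
    right
    rw [← this]
    refine intervalIntegral.integral_congr fun x _ => ?_
    simp only [expTwoPi]
    congr 2
    push_cast
    ring
  have hs := has_pointwise_sum_fourier_series_of_summable (f := g) (by rw [hc]; exact summable_zero)
    (x : AddCircle (1 : ℝ))
  rw [hc, hg] at hs
  simp only [Pi.zero_apply, zero_smul] at hs
  exact hs.unique hasSum_zero

/-- A theta function of degree one, vanishing in the zeroth Fourier coefficient, is zero. -/
lemma eq_zero_of_quasiPeriodic {τ : ℂ} {f : ℂ → ℂ} (hf : Differentiable ℂ f)
    (h1 : ∀ z, f (z + 1) = f z) (hτ : ∀ z, f (z + τ) = -expTwoPi (-z) * f z)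
    (h0 : ∫ x in (0 : ℝ)..1, f x = 0) (z : ℂ) : f z = 0 := by
  have hper : ∀ (n : ℤ) z, expTwoPi (n * (z + 1)) * f (z + 1) = expTwoPi (n * z) * f z :=
    fun n z => by rw [h1, mul_add, expTwoPi_add, mul_one, expTwoPi_intCast, mul_one]
  have hdiff : ∀ (n : ℤ), Differentiable ℂ fun z => expTwoPi (n * z) * f z := fun n => by
    fun_prop
  have shift : ∀ (n : ℤ) (c : ℂ), ∫ x in (0 : ℝ)..1, expTwoPi (n * (x + c)) * f (x + c) =
      ∫ x in (0 : ℝ)..1, expTwoPi (n * x) * f x := fun n c => by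
    have := integral_horizontal_eq_of_periodic (hper n) (c := c) (d := 0)
      fun z _ => hdiff n z
    simpa only [add_zero] using this
  -- Moving the segment up by τ ties each Fourier coefficient to its neighbour by a nonzero factor,
  -- so the vanishing of one kills all.
  have step : ∀ n : ℤ, ∫ x in (0 : ℝ)..1, expTwoPi (n * x) * f x =
      -expTwoPi (n * τ) * ∫ x in (0 : ℝ)..1, expTwoPi ((n - 1 : ℤ) * x) * f x := fun n => by
    rw [← shift n τ, ← intervalIntegral.integral_const_mul]
    refine intervalIntegral.integral_congr fun x _ => ?_
    simp only [hτ]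
    have : ((n - 1 : ℤ) : ℂ) * x = n * x + -x := by push_cast; ring
    rw [this, mul_add, expTwoPi_add, expTwoPi_add]
    ring
  have all : ∀ n : ℤ, ∫ x in (0 : ℝ)..1, expTwoPi (n * x) * f x = 0 := fun n => by
    induction n with
    | zero => simpa using h0
    | succ n ih =>
      rw [step, add_sub_cancel_right, ih, mul_zero]
    | pred n ih =>
      rw [step] at ih
      exact (mul_eq_zero.1 ih).resolve_left (neg_ne_zero.2 (expTwoPi_ne_zero _))
  -- Uniqueness is applied on the horizontal line through z, where the coefficients also vanish
  -- because segments may be shifted.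
  have key := eq_zero_of_fourier_integral_eq_zero (f := fun x : ℝ => f (x + z))
    (hf.continuous.comp (by fun_prop)) (fun x => by
      simp only; rw [← h1 (x + z)]; push_cast; ring_nf) (fun n => ?_) 0
  · simpa using key
  · have := shift n z
    rw [all n] at this
    simp only [mul_add, expTwoPi_add] at this
    have h' : ∫ x in (0 : ℝ)..1, expTwoPi (n * z) * (expTwoPi (n * x) * f (x + z)) = 0 := by
      rw [← this]
      exact intervalIntegral.integral_congr fun x _ => by ring
    rw [intervalIntegral.integral_const_mul] at h'
    exact (mul_eq_zero.1 h').resolve_left (expTwoPi_ne_zero _)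

lemma theta_eq_jacobiTheta₂ (z τ : ℂ) : theta z τ =
    -(cexp (Real.pi * I * (τ / 4 + z + 1 / 2)) * jacobiTheta₂ (z + 1 / 2 + τ / 2) τ) := by
  rw [theta, jacobiTheta₂, ← tsum_mul_left]
  congr 1
  refine tsum_congr fun n => ?_
  rw [jacobiTheta₂_term, ← Complex.exp_add]
  ring_nf

variable {τ σ : ℂ}

lemma differentiable_theta (hτ : 0 < τ.im) : Differentiable ℂ fun z => theta z τ := by
  simp only [theta_eq_jacobiTheta₂]
  intro z
  have := (differentiableAt_jacobiTheta₂_fst (z + 1 / 2 + τ / 2) hτ).comp z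
    (f := fun z => z + 1 / 2 + τ / 2) (by fun_prop)
  simp only [Function.comp_def] at this
  fun_prop

lemma theta_add_one (z τ : ℂ) : theta (z + 1) τ = -theta z τ := by
  rw [theta_eq_jacobiTheta₂, theta_eq_jacobiTheta₂,
    show z + 1 + 1 / 2 + τ / 2 = z + 1 / 2 + τ / 2 + 1 by ring, jacobiTheta₂_add_left,
    show (Real.pi * I * (τ / 4 + (z + 1) + 1 / 2) : ℂ) =
      Real.pi * I * (τ / 4 + z + 1 / 2) + Real.pi * I by ring, Complex.exp_add, exp_pi_mul_I]
  ring

lemma theta_add_tau (z τ : ℂ) :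
    theta (z + τ) τ = -cexp (-(Real.pi * I * (τ + 2 * z))) * theta z τ := by
  rw [theta_eq_jacobiTheta₂, theta_eq_jacobiTheta₂,
    show z + τ + 1 / 2 + τ / 2 = z + 1 / 2 + τ / 2 + τ by ring, jacobiTheta₂_add_left']
  have : cexp (Real.pi * I * (τ / 4 + (z + τ) + 1 / 2)) *
      cexp (-Real.pi * I * (τ + 2 * (z + 1 / 2 + τ / 2))) =
      -cexp (-(Real.pi * I * (τ + 2 * z))) * cexp (Real.pi * I * (τ / 4 + z + 1 / 2)) := by
    have e : ∀ w, -cexp w = cexp (-(Real.pi * I) + w) := fun w => by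
      rw [Complex.exp_add, exp_neg_pi_mul_I, neg_one_mul]
    rw [← Complex.exp_add, neg_mul (cexp _), ← Complex.exp_add, e]
    ring_nf
  linear_combination -jacobiTheta₂ (z + 1 / 2 + τ / 2) τ * this

/-- Jacobi's triple product, up to the constant. -/
lemma exists_theta_eq_expProd (hτ : 0 < τ.im) : ∃ C : ℂ, ∀ z, theta z τ =
    C * expTwoPi (-z / 2) * (expProd (pochShift τ) z * expProd (pochShift τ) (-z + τ)) := by
  set V := expProd (pochShift τ)
  have hV : Differentiable ℂ V := differentiable_expProd (summable_pochShift hτ)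
  set f : ℂ → ℂ := fun z => V z * V (-z + τ) with hf
  set g : ℂ → ℂ := fun z => expTwoPi (z / 2) * theta z τ with hg
  have hfd : Differentiable ℂ f := by fun_prop
  have hgd : Differentiable ℂ g := by
    have := differentiable_theta hτ
    fun_prop
  have hf1 : ∀ z, f (z + 1) = f z := fun z => by
    simp only [hf, V, expProd_add_one]
    rw [← expProd_add_one _ (-(z + 1) + τ)]
    ring_nf
  have hfτ : ∀ z, f (z + τ) = -expTwoPi (-z) * f z := fun z => by
    simp only [hf, V]
    rw [show -(z + τ) + τ = -z by ring, expProd_pochShift hτ (-z), expProd_pochShift hτ z]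
    have := expTwoPi_ne_zero z
    rw [expTwoPi_neg]
    field_simp
    ring
  have hg1 : ∀ z, g (z + 1) = g z := fun z => by
    simp only [hg, theta_add_one, add_div, expTwoPi_add]
    have : expTwoPi (1 / 2) = -1 := by
      rw [expTwoPi, ← exp_pi_mul_I]; ring_nf
    rw [this]; ring
  have hgτ : ∀ z, g (z + τ) = -expTwoPi (-z) * g z := fun z => by
    simp only [hg, theta_add_tau, add_div, expTwoPi_add]
    have : expTwoPi (τ / 2) * cexp (-(Real.pi * I * (τ + 2 * z))) = expTwoPi (-z) := by
      rw [expTwoPi, expTwoPi, ← Complex.exp_add]; ring_nf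
    linear_combination -expTwoPi (z / 2) * theta z τ * this
  set a := ∫ x in (0 : ℝ)..1, f x
  set b := ∫ x in (0 : ℝ)..1, g x
  have hint : ∀ (u : ℂ → ℂ), Differentiable ℂ u →
      IntervalIntegrable (fun x : ℝ => u x) MeasureTheory.volume 0 1 := fun u hu =>
    (hu.continuous.comp continuous_ofReal).intervalIntegrable _ _
  -- Otherwise the product would vanish identically, but at z = τ/2 every factor is 1 - w with |w| <
  -- 1.
  have ha : a ≠ 0 := by
    intro ha
    have h0 := eq_zero_of_quasiPeriodic hfd hf1 hfτ ha (τ / 2)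
    refine (mul_ne_zero ?_ ?_) h0 <;>
    · refine expProd_ne_zero (summable_pochShift hτ) fun i => ?_
      simp [pochShift]
      have : (0 : ℝ) ≤ i * τ.im := by positivity
      linarith
  refine ⟨b / a, fun z => ?_⟩
  have key := eq_zero_of_quasiPeriodic (f := fun z => a * g z - b * f z) (τ := τ)
    (by fun_prop) (fun z => by rw [hf1, hg1]) (fun z => by rw [hfτ, hgτ]; ring) (by
      rw [intervalIntegral.integral_sub ((hint g hgd).const_mul a) ((hint f hfd).const_mul b),
        intervalIntegral.integral_const_mul, intervalIntegral.integral_const_mul]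
      ring) z
  have hz : expTwoPi (-z / 2) * expTwoPi (z / 2) = 1 := by
    rw [← expTwoPi_add]; ring_nf; simp
  simp only [hg, hf] at key
  rw [div_mul_eq_mul_div, div_mul_eq_mul_div, eq_div_iff ha]
  linear_combination expTwoPi (-z / 2) * key - a * theta z τ * hz

end

/-! ### Symmetric form of the integrand. -/

section

lemma countable_setOf_expProd_eq_zero {ι : Type*} [Countable ι] {c : ι → ℂ}
    (hc : Summable fun i => ‖expTwoPi (c i)‖) {ε : ℂ} (hε : ε ≠ 0) (b : ℂ) :
    {z : ℂ | expProd c (ε * z + b) = 0}.Countable := by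
  refine (Set.countable_range fun p : ι × ℤ => (p.2 - b - c p.1) / ε).mono ?_
  intro z hz
  obtain ⟨i, hi⟩ := (expProd_eq_zero_iff hc _).1 hz
  obtain ⟨n, hn⟩ := (expTwoPi_eq_one_iff _).1 hi
  refine ⟨(i, n), ?_⟩
  simp only [← hn]
  field_simp
  ring

variable {τ σ : ℂ}

lemma Omega_eq_expProd (hτ : 0 < τ.im) (hσ : 0 < σ.im) {a t : ℂ}
    (h1 : expProd (dblShift τ σ) (t + a) ≠ 0)
    (h2 : expProd (dblShift τ σ) (-t + a + (τ + σ)) ≠ 0) :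
    Omega a t τ σ = expProd (dblShift τ σ) (t - a) * expProd (dblShift τ σ) (-t - a + (τ + σ)) /
      (expProd (dblShift τ σ) (t + a) * expProd (dblShift τ σ) (-t + a + (τ + σ))) := by
  have hp := fun x => (multipliable_expProd (summable_dblShift hτ hσ) x).hasProd
  rw [expProd, expProd, expProd, expProd, ← (HasProd.div₀ ((hp (t - a)).mul (hp (-t - a + (τ + σ))))
    ((hp (t + a)).mul (hp (-t + a + (τ + σ)))) (mul_ne_zero h1 h2)).tprod_eq,
    Omega]
  refine tprod_congr fun p => ?_
  simp only [expTwoPi, dblShift]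
  ring_nf

/-- The symmetric form of the integrand of the hypergeometric integral, without the theta functions
in the numerator: `∏ (1 - e(t - a + jτ + kσ)) (1 - e(-t - a + jτ + kσ))` over `j, k ≥ 1`, divided by
`∏ (1 - e(t + a + jτ + kσ)) (1 - e(-t + a + jτ + kσ))` over `j, k ≥ 0`. -/
def phaseKernel (τ σ a t : ℂ) : ℂ :=
  expProd (dblShift τ σ) (t - a + (τ + σ)) * expProd (dblShift τ σ) (-t - a + (τ + σ)) /
    (expProd (dblShift τ σ) (t + a) * expProd (dblShift τ σ) (-t + a))

lemma expProd_dblShift_ne_zero (hτ : 0 < τ.im) (hσ : 0 < σ.im) {x : ℂ} (hx : 0 < x.im) :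
    expProd (dblShift τ σ) x ≠ 0 := by
  refine expProd_ne_zero (summable_dblShift hτ hσ) fun p => ?_
  have : 0 ≤ (p.1 : ℝ) * τ.im := by positivity
  have : 0 ≤ (p.2 : ℝ) * σ.im := by positivity
  simp [dblShift]
  linarith

/-- With z = t - a, the theta functions cancel the factors of the numerator of Ω with j = 0 or k = 0
and supply the missing boundary factors of the denominator. What remains is e(z) / (1 - e(z)) = -1 /
(1 - e(-z)), the missing corner factor and the source of the sign. Points t where a theta factor
vanishes are exceptional, hence the equality almost everywhere. -/
lemma exists_Omega_div_theta_eq (hτ : 0 < τ.im) (hσ : 0 < σ.im) : ∃ C : ℂ, ∀ a : ℂ, 0 < a.im →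
    ∀ᵐ t : ℝ, Omega a t τ σ / (theta (t - a) τ * theta (t - a) σ) = C * phaseKernel τ σ a t := by
  obtain ⟨A, hA⟩ := exists_theta_eq_expProd hτ
  obtain ⟨B, hB⟩ := exists_theta_eq_expProd hσ
  refine ⟨-(A * B)⁻¹, fun a ha => ?_⟩
  have hae : ∀ {ρ : ℂ}, 0 < ρ.im → ∀ {ε : ℂ}, ε ≠ 0 → ∀ b : ℂ,
      ∀ᵐ t : ℝ, expProd (pochShift ρ) (ε * t + b) ≠ 0 := fun hρ ε hε b => by
    rw [MeasureTheory.ae_iff]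
    refine Set.Countable.measure_zero ?_ _
    simp only [not_not]
    exact (countable_setOf_expProd_eq_zero (summable_pochShift hρ) hε b).preimage ofReal_injective
  filter_upwards [hae hτ one_ne_zero (-a), hae hσ one_ne_zero (-a),
    hae hτ (neg_ne_zero.2 one_ne_zero) (a + τ), hae hσ (neg_ne_zero.2 one_ne_zero) (a + σ)]
    with t h1 h2 h3 h4
  have e1 : (1 : ℂ) * t + -a = t - a := by ring
  have e2 : ∀ ρ : ℂ, (-1 : ℂ) * t + (a + ρ) = -(t - a) + ρ := fun ρ => by ring
  rw [e1] at h1 h2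
  rw [e2] at h3 h4
  have hW1 : expProd (dblShift τ σ) (t + a) ≠ 0 :=
    expProd_dblShift_ne_zero hτ hσ (by simpa using ha)
  have hW2 : expProd (dblShift τ σ) (-t + a) ≠ 0 :=
    expProd_dblShift_ne_zero hτ hσ (by simpa using ha)
  have hW3 : expProd (dblShift τ σ) (-t + a + (τ + σ)) ≠ 0 :=
    expProd_dblShift_ne_zero hτ hσ (by simp; linarith)
  rw [Omega_eq_expProd hτ hσ hW1 hW3, hA, hB, phaseKernel]
  have hz1 : expProd (dblShift τ σ) (t - a) = expProd (pochShift τ) (t - a) *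
      (expProd (pochShift σ) (t - a + σ) * expProd (dblShift τ σ) (t - a + (τ + σ))) := by
    rw [expProd_dblShift_right hτ hσ, expProd_dblShift_left hτ hσ]; ring_nf
  have hz2 : expProd (dblShift τ σ) (-t + a) = (1 - expTwoPi (-(t - a))) *
      expProd (pochShift τ) (-(t - a) + τ) *
      (expProd (pochShift σ) (-(t - a) + σ) * expProd (dblShift τ σ) (-t + a + (τ + σ))) := by
    rw [expProd_dblShift_right hτ hσ, expProd_dblShift_left hτ hσ, expProd_pochShift hτ]; ring_nf
  have hz3 := expProd_pochShift hσ (t - a)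
  rw [hz2] at hW2 ⊢
  rw [hz3] at h2 ⊢
  rw [hz1]
  have h5 : 1 - expTwoPi (t - a) ≠ 0 := left_ne_zero_of_mul h2
  have h6 : expProd (pochShift σ) (t - a + σ) ≠ 0 := right_ne_zero_of_mul h2
  have h7 : 1 - expTwoPi (-(t - a)) ≠ 0 := left_ne_zero_of_mul (left_ne_zero_of_mul hW2)
  have h8 : expTwoPi (-(t - a) / 2) ≠ 0 := expTwoPi_ne_zero _
  have h9 : expTwoPi (-(t - a) / 2) * expTwoPi (-(t - a) / 2) = expTwoPi (-(t - a)) := by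
    rw [← expTwoPi_add]; ring_nf
  have h10 : 1 - expTwoPi (-(t - a)) = -expTwoPi (-(t - a)) * (1 - expTwoPi (t - a)) := by
    have : expTwoPi (-(t - a)) * expTwoPi (t - a) = 1 := by
      rw [← expTwoPi_add]; simp
    linear_combination -this
  rw [h10, ← h9]
  -- The constants are not known to be nonzero; if one is zero, both sides are zero because division
  -- by zero gives zero.
  rcases eq_or_ne A 0 with rfl | hA0
  · simp
  rcases eq_or_ne B 0 with rfl | hB0
  · simp
  field_simp

/-- The hypergeometric integral with the integrand in symmetric form. -/
lemma exists_uIntegral_eq (hτ : 0 < τ.im) (hσ : 0 < σ.im) : ∃ C : ℂ, ∀ lam μ η : ℂ, 0 < η.im →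
    uIntegral lam μ τ σ η = cexp (-(Real.pi * I * lam * μ / (2 * η))) *
      (C * ∫ t in (0 : ℝ)..1, theta (lam + t) τ * theta (μ + t) σ * phaseKernel τ σ (2 * η) t) := by
  obtain ⟨C, hC⟩ := exists_Omega_div_theta_eq hτ hσ
  refine ⟨C, fun lam μ η hη => ?_⟩
  rw [uIntegral, ← intervalIntegral.integral_const_mul C]
  congr 1
  refine intervalIntegral.integral_congr_ae ?_
  filter_upwards [hC (2 * η) (by simpa using hη)] with t ht _
  rw [mul_div_assoc', mul_comm, mul_div_assoc, ht]
  ring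

end

/-! ### Continuing an integral by partial fractions. -/

section

/-- Holomorphic dependence on the parameter of an integral over a horizontal segment. -/
lemma differentiableOn_integral_horizontal {g : ℂ × ℂ → ℂ} {U : Set ℂ} (hU : IsOpen U) (c : ℂ)
    (hg : ∀ x ∈ Set.Icc (0 : ℝ) 1, ∀ η ∈ U, AnalyticAt ℂ g (x + c, η)) :
    DifferentiableOn ℂ (fun η => ∫ x in (0 : ℝ)..1, g (x + c, η)) U := by
  intro η₀ hη₀
  obtain ⟨r, hr, hrU⟩ := Metric.nhds_basis_closedBall.mem_iff.1 (hU.mem_nhds hη₀)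
  set K : Set (ℝ × ℂ) := Set.Icc (0 : ℝ) 1 ×ˢ Metric.closedBall η₀ r
  have hK : IsCompact K := isCompact_Icc.prod (isCompact_closedBall _ _)
  have hKa : ∀ p ∈ K, AnalyticAt ℂ g (p.1 + c, p.2) := fun p hp => hg p.1 hp.1 p.2 (hrU hp.2)
  have hmap : Continuous fun p : ℝ × ℂ => ((p.1 + c, p.2) : ℂ × ℂ) := by fun_prop
  have hcont : ContinuousOn (fun p : ℝ × ℂ => g (p.1 + c, p.2)) K := fun p hp =>
    ((hKa p hp).continuousAt.comp (f := fun p : ℝ × ℂ => ((p.1 + c, p.2) : ℂ × ℂ))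
      hmap.continuousAt).continuousWithinAt
  have hcont' : ContinuousOn (fun p : ℝ × ℂ => fderiv ℂ g (p.1 + c, p.2) (0, 1)) K := fun p hp =>
    (((hKa p hp).fderiv.continuousAt.comp (f := fun p : ℝ × ℂ => ((p.1 + c, p.2) : ℂ × ℂ))
      hmap.continuousAt).clm_apply continuousAt_const).continuousWithinAt
  obtain ⟨B, hB⟩ := hK.exists_bound_of_continuousOn hcont'
  have hsub : Set.uIoc (0 : ℝ) 1 ⊆ Set.Icc 0 1 := by
    rw [Set.uIoc_of_le zero_le_one]; exact Set.Ioc_subset_Icc_self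
  have hslice : ∀ {u : ℝ × ℂ → ℂ}, ContinuousOn u K → ∀ η ∈ Metric.closedBall η₀ r,
      ContinuousOn (fun x : ℝ => u (x, η)) (Set.Icc 0 1) := fun hu η hη =>
    hu.comp (by fun_prop) fun x hx => ⟨hx, hη⟩
  have hmem : η₀ ∈ Metric.closedBall η₀ r := Metric.mem_closedBall_self hr.le
  have key := intervalIntegral.hasDerivAt_integral_of_dominated_loc_of_deriv_le
    (μ := MeasureTheory.volume) (a := 0) (b := 1) (F := fun η (x : ℝ) => g (x + c, η))
    (F' := fun η (x : ℝ) => fderiv ℂ g (x + c, η) (0, 1)) (x₀ := η₀) (bound := fun _ => B)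
    (Metric.closedBall_mem_nhds η₀ hr) ?_ ?_ ?_ ?_ ?_ ?_
  · exact key.2.differentiableAt.differentiableWithinAt
  · filter_upwards [Metric.closedBall_mem_nhds η₀ hr] with η hη
    exact ((hslice hcont η hη).mono hsub).aestronglyMeasurable measurableSet_uIoc
  · refine ContinuousOn.intervalIntegrable ?_
    rw [Set.uIcc_of_le zero_le_one]
    exact hslice hcont η₀ hmem
  · exact ((hslice hcont' η₀ hmem).mono hsub).aestronglyMeasurable measurableSet_uIoc
  · exact .of_forall fun x hx η hη => hB (x, η) ⟨hsub hx, hη⟩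
  · exact intervalIntegrable_const
  · refine .of_forall fun x hx η hη => ?_
    have h1 := (hKa (x, η) ⟨hsub hx, hη⟩).differentiableAt.hasFDerivAt
    have h2 : HasDerivAt (fun η : ℂ => ((x + c, η) : ℂ × ℂ)) (0, 1) η :=
      (hasDerivAt_const _ _).prodMk (hasDerivAt_id _)
    exact h1.comp_hasDerivAt η h2

/-- The product of the factors `1 - b e(t)`. -/
def listProd (bs : List ℂ) (t : ℂ) : ℂ := (bs.map fun b => 1 - b * expTwoPi t).prod

@[simp] lemma listProd_nil (t : ℂ) : listProd [] t = 1 := rfl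

@[simp] lemma listProd_cons (b : ℂ) (bs : List ℂ) (t : ℂ) :
    listProd (b :: bs) t = (1 - b * expTwoPi t) * listProd bs t := rfl

lemma listProd_ne_zero {bs : List ℂ} {t : ℂ} (h : ∀ b ∈ bs, b * expTwoPi t ≠ 1) :
    listProd bs t ≠ 0 := by
  refine List.prod_ne_zero fun h0 => ?_
  obtain ⟨b, hb, h'⟩ := List.mem_map.1 h0
  exact h b hb (sub_eq_zero.1 h').symm

lemma analyticAt_listProd {E : Type*} [NormedAddCommGroup E] [NormedSpace ℂ E] {t : E → ℂ} {x : E}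
    (ht : AnalyticAt ℂ t x) {bs : List (E → ℂ)} (hb : ∀ b ∈ bs, AnalyticAt ℂ b x) :
    AnalyticAt ℂ (fun y => listProd (bs.map fun b => b y) (t y)) x := by
  have he : AnalyticAt ℂ (fun y => expTwoPi (t y)) x :=
    (differentiable_expTwoPi.analyticAt _).comp ht
  induction bs with
  | nil => exact analyticAt_const
  | cons b bs ih =>
    simp only [List.map_cons, listProd_cons]
    exact (analyticAt_const.sub ((hb b (by simp)).mul he)).mul
      (ih fun b hb' => hb b (by simp [hb']))

@[fun_prop] lemma differentiable_listProd (bs : List ℂ) : Differentiable ℂ (listProd bs) := by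
  induction bs with
  | nil => exact differentiable_const _
  | cons b bs ih =>
    change Differentiable ℂ fun t => (1 - b * expTwoPi t) * listProd bs t
    fun_prop

@[fun_prop] lemma continuous_listProd (bs : List ℂ) : Continuous (listProd bs) :=
  (differentiable_listProd bs).continuous

/-- For `as`, `bs` in the unit disc and `F` holomorphic and `1`-periodic in the strip `|Im t| ≤ R`,
this is the integral of `F(t) / ∏ (1 - a e(t)) ∏ (1 - b e(-t))` over `[0, 1]`. It is a form of this
integral that makes sense whenever `ab ≠ 1` for all `a`, `b` in the lists and the `a`, `b` are in
the disc of radius `e^{2πR}`: the identity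
`1 / ((1 - x) (1 - y)) = (1 / (1 - x) + 1 / (1 - y) - 1) / (1 - xy)`
reduces it to the cases where one list is empty, in which one shifts the segment. -/
def splitIntegral (R : ℝ) (F : ℂ → ℂ) : List ℂ → List ℂ → ℂ
  | [], bs => ∫ x in (0 : ℝ)..1, F (x + -(R * I)) / listProd bs (-(x + -(R * I)))
  | a :: as, [] => ∫ x in (0 : ℝ)..1, F (x + R * I) / listProd (a :: as) (x + R * I)
  | a :: as, b :: bs => (splitIntegral R F (a :: as) bs + splitIntegral R F as (b :: bs) -
      splitIntegral R F as bs) / (1 - a * b)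
termination_by as bs => as.length + bs.length

lemma splitIntegral_const_mul (R : ℝ) (F : ℂ → ℂ) (c : ℂ) (as bs : List ℂ) :
    splitIntegral R (fun t => c * F t) as bs = c * splitIntegral R F as bs := by
  induction as, bs using splitIntegral.induct with
  | case1 bs =>
    simp only [splitIntegral, mul_div_assoc]
    rw [intervalIntegral.integral_const_mul]
  | case2 a as =>
    simp only [splitIntegral, mul_div_assoc]
    rw [intervalIntegral.integral_const_mul]
  | case3 a as b bs h1 h2 h3 =>
    rw [splitIntegral, h1, h2, h3, splitIntegral]
    ring

/-- The constant depends on the lists but not on F; this uniformity is what later controls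
infinitely many summands at a fixed η. -/
lemma exists_norm_splitIntegral_le (R : ℝ) (as bs : List ℂ)
    (has : ∀ a ∈ as, ∀ x ∈ Set.Icc (0 : ℝ) 1, a * expTwoPi (x + R * I) ≠ 1)
    (hbs : ∀ b ∈ bs, ∀ x ∈ Set.Icc (0 : ℝ) 1, b * expTwoPi (-(x + -(R * I))) ≠ 1) :
    ∃ C : ℝ, 0 ≤ C ∧ ∀ (F : ℂ → ℂ) (B : ℝ), (∀ x ∈ Set.Icc (0 : ℝ) 1,
      ‖F (x + R * I)‖ ≤ B ∧ ‖F (x + -(R * I))‖ ≤ B) → ‖splitIntegral R F as bs‖ ≤ C * B := by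
  have base : ∀ {P : ℝ → ℂ}, Continuous P → (∀ x ∈ Set.Icc (0 : ℝ) 1, P x ≠ 0) →
      ∃ C : ℝ, 0 ≤ C ∧ ∀ (F : ℝ → ℂ) (B : ℝ), (∀ x ∈ Set.Icc (0 : ℝ) 1, ‖F x‖ ≤ B) →
        ‖∫ x in (0 : ℝ)..1, F x / P x‖ ≤ C * B := fun {P} hP hP0 => by
    obtain ⟨C, hC⟩ := isCompact_Icc.exists_bound_of_continuousOn (s := Set.Icc (0 : ℝ) 1)
      (f := fun x => (P x)⁻¹) (hP.continuousOn.inv₀ hP0)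
    have hC0 : 0 ≤ C := (norm_nonneg _).trans (hC 0 (by simp))
    refine ⟨C, hC0, fun F B hF => ?_⟩
    refine (intervalIntegral.norm_integral_le_of_norm_le_const (C := C * B) fun x hx => ?_).trans
      (by simp)
    have hx' : x ∈ Set.Icc (0 : ℝ) 1 := by
      rw [Set.uIoc_of_le zero_le_one] at hx; exact Set.Ioc_subset_Icc_self hx
    rw [div_eq_mul_inv, norm_mul, mul_comm]
    exact mul_le_mul (hC x hx') (hF x hx') (norm_nonneg _) hC0
  induction as, bs using splitIntegral.induct with
  | case1 bs =>
    obtain ⟨C, hC0, hC⟩ := base (P := fun x => listProd bs (-(x + -(R * I)))) (by fun_prop)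
      fun x hx => listProd_ne_zero fun b hb => hbs b hb x hx
    exact ⟨C, hC0, fun F B hF => by
      rw [splitIntegral]; exact hC (fun x => F (x + -(R * I))) B fun x hx => (hF x hx).2⟩
  | case2 a as =>
    obtain ⟨C, hC0, hC⟩ := base (P := fun x => listProd (a :: as) (x + R * I)) (by fun_prop)
      fun x hx => listProd_ne_zero fun b hb => has b hb x hx
    exact ⟨C, hC0, fun F B hF => by
      rw [splitIntegral]; exact hC (fun x => F (x + R * I)) B fun x hx => (hF x hx).1⟩
  | case3 a as b bs h1 h2 h3 =>
    have has' := fun a' (h : a' ∈ as) => has a' (List.mem_cons_of_mem _ h)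
    have hbs' := fun b' (h : b' ∈ bs) => hbs b' (List.mem_cons_of_mem _ h)
    obtain ⟨C₁, hC₁, h1⟩ := h1 has hbs'
    obtain ⟨C₂, hC₂, h2⟩ := h2 has' hbs
    obtain ⟨C₃, hC₃, h3⟩ := h3 has' hbs'
    refine ⟨(C₁ + C₂ + C₃) / ‖1 - a * b‖, by positivity, fun F B hF => ?_⟩
    rw [splitIntegral, norm_div, div_mul_eq_mul_div]
    gcongr
    calc _ ≤ ‖splitIntegral R F (a :: as) bs‖ + ‖splitIntegral R F as (b :: bs)‖ +
          ‖splitIntegral R F as bs‖ := (norm_sub_le _ _).trans (by gcongr; exact norm_add_le _ _)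
      _ ≤ C₁ * B + C₂ * B + C₃ * B := by gcongr; exacts [h1 F B hF, h2 F B hF, h3 F B hF]
      _ = _ := by ring

/-- The base integrals have no pole on their segments, and the recursion only divides by 1 - ab, so
ab ≠ 1 is the sole further obstruction to holomorphy. -/
lemma differentiableOn_splitIntegral (R : ℝ) {F : ℂ × ℂ → ℂ} {U : Set ℂ} (hU : IsOpen U)
    (hF : ∀ x ∈ Set.Icc (0 : ℝ) 1, ∀ η ∈ U,
      AnalyticAt ℂ F (x + R * I, η) ∧ AnalyticAt ℂ F (x + -(R * I), η))
    (as bs : List (ℂ → ℂ)) (has : ∀ a ∈ as, DifferentiableOn ℂ a U)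
    (hbs : ∀ b ∈ bs, DifferentiableOn ℂ b U)
    (has' : ∀ a ∈ as, ∀ η ∈ U, ∀ x ∈ Set.Icc (0 : ℝ) 1, a η * expTwoPi (x + R * I) ≠ 1)
    (hbs' : ∀ b ∈ bs, ∀ η ∈ U, ∀ x ∈ Set.Icc (0 : ℝ) 1, b η * expTwoPi (-(x + -(R * I))) ≠ 1)
    (hab : ∀ a ∈ as, ∀ b ∈ bs, ∀ η ∈ U, a η * b η ≠ 1) :
    DifferentiableOn ℂ (fun η => splitIntegral R (fun t => F (t, η)) (as.map fun a => a η)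
      (bs.map fun b => b η)) U := by
  have hsnd : ∀ {b : ℂ → ℂ}, DifferentiableOn ℂ b U → ∀ (t : ℂ), ∀ η ∈ U,
      AnalyticAt ℂ (fun p : ℂ × ℂ => b p.2) (t, η) := fun hb t η hη =>
    (hb.analyticAt (hU.mem_nhds hη)).fun_comp analyticAt_snd
  have hprod : ∀ {bs : List (ℂ → ℂ)}, (∀ b ∈ bs, DifferentiableOn ℂ b U) → ∀ {s : ℂ × ℂ → ℂ}
      {t η : ℂ}, AnalyticAt ℂ s (t, η) → η ∈ U →
      AnalyticAt ℂ (fun p : ℂ × ℂ => listProd (bs.map fun b => b p.2) (s p)) (t, η) :=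
    fun {bs} hb s t η hs hη => by
    have := analyticAt_listProd (x := (t, η)) hs (bs := bs.map fun b p => b p.2) fun b hb' => by
      obtain ⟨b', hb'', rfl⟩ := List.mem_map.1 hb'
      exact hsnd (hb b' hb'') t η hη
    simpa only [List.map_map, Function.comp_def] using this
  match as, bs with
  | [], bs =>
    simp only [List.map_nil, splitIntegral]
    refine differentiableOn_integral_horizontal
      (g := fun p => F p / listProd (bs.map fun b => b p.2) (-p.1)) hU _ fun x hx η hη => ?_
    refine (hF x hx η hη).2.div (hprod hbs analyticAt_fst.neg hη) (listProd_ne_zero ?_)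
    intro b hb
    obtain ⟨b', hb', rfl⟩ := List.mem_map.1 hb
    exact hbs' b' hb' η hη x hx
  | a :: as, [] =>
    simp only [List.map_cons, List.map_nil, splitIntegral]
    refine differentiableOn_integral_horizontal
      (g := fun p => F p / listProd ((a :: as).map fun b => b p.2) p.1) hU _ fun x hx η hη => ?_
    refine (hF x hx η hη).1.div (hprod has analyticAt_fst hη) (listProd_ne_zero ?_)
    intro b hb
    obtain ⟨b', hb', rfl⟩ := List.mem_map.1 hb
    exact has' b' hb' η hη x hx
  | a :: as, b :: bs =>
    have m : ∀ {p : (ℂ → ℂ) → Prop} {a as}, (∀ b ∈ a :: as, p b) → ∀ b ∈ as, p b :=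
      fun h b hb => h b (List.mem_cons_of_mem _ hb)
    have h1 := differentiableOn_splitIntegral R hU hF (a :: as) bs has (m hbs) has' (m hbs')
      fun a' ha' => m (hab a' ha')
    have h2 := differentiableOn_splitIntegral R hU hF as (b :: bs) (m has) hbs (m has') hbs' (m hab)
    have h3 := differentiableOn_splitIntegral R hU hF as bs (m has) (m hbs) (m has') (m hbs')
      fun a' ha' => m (m hab a' ha')
    simp only [List.map_cons] at h1 h2 ⊢
    simp only [splitIntegral]
    have ha := has a (by simp)
    have hb := hbs b (by simp)
    refine ((h1.add h2).sub h3).div ((differentiableOn_const _).sub (ha.mul hb)) fun η hη => ?_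
    exact sub_ne_zero.2 (hab a (by simp) b (by simp) η hη).symm
termination_by as.length + bs.length

/-- If all a and b lie in the unit disc, no pole lies between the real axis and the line used in a
base case, and the recursive step is a pointwise identity under the integral. -/
lemma splitIntegral_eq {R : ℝ} (hR : 0 ≤ R) {F : ℂ → ℂ} (hF1 : ∀ z, F (z + 1) = F z)
    (hF : ∀ z : ℂ, |z.im| ≤ R → DifferentiableAt ℂ F z) (as bs : List ℂ)
    (has : ∀ a ∈ as, ‖a‖ < 1) (hbs : ∀ b ∈ bs, ‖b‖ < 1) :
    splitIntegral R F as bs =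
      ∫ x in (0 : ℝ)..1, F x / (listProd as x * listProd bs (-x)) := by
  have hne : ∀ {b t : ℂ}, ‖b‖ < 1 → 0 ≤ t.im → b * expTwoPi t ≠ 1 := fun {b t} hb ht h => by
    have h1 : ‖expTwoPi t‖ ≤ 1 := by
      rw [norm_expTwoPi, Real.exp_le_one_iff]
      have := Real.pi_pos
      have : 0 ≤ 2 * Real.pi * t.im := by positivity
      linarith
    have h2 := congrArg norm h
    rw [norm_mul, norm_one] at h2
    nlinarith [norm_nonneg b, norm_nonneg (expTwoPi t)]
  have hper : ∀ (cs : List ℂ) (t : ℂ), listProd cs (t + 1) = listProd cs t := fun cs t => by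
    simp only [listProd, expTwoPi_add, expTwoPi_one, mul_one]
  have hper' : ∀ (cs : List ℂ) (t : ℂ), listProd cs (-(t + 1)) = listProd cs (-t) := fun cs t => by
    rw [← hper cs (-(t + 1))]; ring_nf
  have hint : ∀ cs ds : List ℂ, (∀ a ∈ cs, ‖a‖ < 1) → (∀ b ∈ ds, ‖b‖ < 1) →
      IntervalIntegrable (fun x : ℝ => F x / (listProd cs x * listProd ds (-x)))
        MeasureTheory.volume 0 1 := fun cs ds hcs hds => by
    refine ContinuousOn.intervalIntegrable (ContinuousOn.div ?_ (by fun_prop) fun x _ =>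
      mul_ne_zero (listProd_ne_zero fun a ha => hne (hcs a ha) (by simp))
        (listProd_ne_zero fun a ha => hne (hds a ha) (by simp)))
    exact fun x _ => ((hF x (by simpa using hR)).continuousAt.comp
      continuous_ofReal.continuousAt).continuousWithinAt
  induction as, bs using splitIntegral.induct with
  | case1 bs =>
    rw [splitIntegral]
    have := integral_horizontal_eq_of_periodic (F := fun t => F t / listProd bs (-t))
      (c := -(R * I)) (d := 0) (fun z => by simp only [hF1, hper']) fun z hz => ?_
    · simpa using this
    · simp only [neg_im, mul_im, ofReal_re, I_im, mul_one, ofReal_im, I_re, mul_zero, add_zero,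
        zero_im] at hz
      rw [Set.uIcc_of_le (by linarith)] at hz
      refine (hF z (abs_le.2 ⟨hz.1, hz.2.trans hR⟩)).div
        ((differentiable_listProd bs _).comp z differentiableAt_id.neg) (listProd_ne_zero ?_)
      exact fun b hb => hne (hbs b hb) (by simpa using hz.2)
  | case2 a as =>
    rw [splitIntegral]
    have := integral_horizontal_eq_of_periodic (F := fun t => F t / listProd (a :: as) t)
      (c := R * I) (d := 0) (fun z => by simp only [hF1, hper]) fun z hz => ?_
    · simpa using this
    · simp only [mul_im, ofReal_re, I_im, mul_one, ofReal_im, I_re, mul_zero, add_zero,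
        zero_im] at hz
      rw [Set.uIcc_of_ge (by linarith)] at hz
      refine (hF z (abs_le.2 ⟨(by linarith [hz.1]), hz.2⟩)).div
        (differentiable_listProd (a :: as) z) (listProd_ne_zero ?_)
      exact fun b hb => hne (has b hb) hz.1
  | case3 a as b bs h1 h2 h3 =>
    have has' := fun a' (h : a' ∈ as) => has a' (List.mem_cons_of_mem _ h)
    have hbs' := fun b' (h : b' ∈ bs) => hbs b' (List.mem_cons_of_mem _ h)
    have ha : ‖a‖ < 1 := has a (by simp)
    have hb : ‖b‖ < 1 := hbs b (by simp)
    rw [splitIntegral, h1 has hbs', h2 has' hbs, h3 has' hbs',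
      ← intervalIntegral.integral_add (hint _ _ has hbs') (hint _ _ has' hbs),
      ← intervalIntegral.integral_sub ((hint _ _ has hbs').add (hint _ _ has' hbs))
        (hint _ _ has' hbs'), ← intervalIntegral.integral_div]
    refine intervalIntegral.integral_congr fun x _ => ?_
    have hab : 1 - a * b ≠ 0 := by
      rw [sub_ne_zero]
      have : b * expTwoPi 0 ≠ 1 := hne hb (by simp)
      intro h
      have h2 := congrArg norm h
      rw [norm_mul, norm_one] at h2
      nlinarith [norm_nonneg b, norm_nonneg a]
    have hax : 1 - a * expTwoPi x ≠ 0 := sub_ne_zero.2 (hne ha (by simp)).symm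
    have hbx : 1 - b * expTwoPi (-x) ≠ 0 := sub_ne_zero.2 (hne hb (by simp)).symm
    have hA : listProd as x ≠ 0 := listProd_ne_zero fun a ha => hne (has' a ha) (by simp)
    have hB : listProd bs (-x) ≠ 0 := listProd_ne_zero fun a ha => hne (hbs' a ha) (by simp)
    have he : expTwoPi x * expTwoPi (-x) = 1 := by rw [← expTwoPi_add]; simp
    simp only [listProd_cons]
    field_simp
    linear_combination -F x * a * b * he

end

/-! ### The regular set and the continuation in η. -/

section

variable {τ σ : ℂ}

lemma dblShift_im (p : ℕ × ℕ) : (dblShift τ σ p).im = p.1 * τ.im + p.2 * σ.im := by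
  simp [dblShift]

lemma mem_regularSet_iff {η : ℂ} :
    η ∈ regularSet τ σ ↔ ∀ p, expTwoPi (4 * η + dblShift τ σ p) ≠ 1 := by
  simp only [regularSet, Set.mem_ofPred_eq, Ne, expTwoPi_eq_one_iff, dblShift, Prod.forall,
    not_exists]
  constructor
  · intro h m n l hl
    refine h (-l) m n ?_
    push_cast
    linear_combination hl
  · intro h l m n hl
    refine h m n (-l) ?_
    push_cast
    linear_combination hl

lemma regularSet_eq (hτ : 0 < τ.im) (hσ : 0 < σ.im) :
    regularSet τ σ = {η | expProd (dblShift τ σ) (4 * η) ≠ 0} := by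
  ext η
  rw [mem_regularSet_iff, Set.mem_ofPred_eq, Ne, expProd_eq_zero_iff (summable_dblShift hτ hσ)]
  push Not
  rfl

lemma isOpen_regularSet (hτ : 0 < τ.im) (hσ : 0 < σ.im) : IsOpen (regularSet τ σ) := by
  rw [regularSet_eq hτ hσ]
  exact isOpen_ne_fun ((differentiable_expProd (summable_dblShift hτ hσ)).continuous.comp
    (by fun_prop)) continuous_const

lemma countable_compl_regularSet (hτ : 0 < τ.im) (hσ : 0 < σ.im) :
    (regularSet τ σ)ᶜ.Countable := by
  have := countable_setOf_expProd_eq_zero (summable_dblShift hτ hσ) (ε := 4) (by norm_num) 0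
  rw [regularSet_eq hτ hσ]
  simpa [Set.compl_ofPred] using this

lemma mem_regularSet_of_im_pos (hτ : 0 < τ.im) (hσ : 0 < σ.im) {η : ℂ} (hη : 0 < η.im) :
    η ∈ regularSet τ σ := by
  rw [regularSet_eq hτ hσ]
  exact expProd_dblShift_ne_zero hτ hσ (by simpa using hη)

lemma ne_zero_of_mem_regularSet {η : ℂ} (hη : η ∈ regularSet τ σ) : η ≠ 0 := by
  rintro rfl
  simpa using hη 0 0 0

lemma exists_finset_lt_dblShift_im (hτ : 0 < τ.im) (hσ : 0 < σ.im) (B : ℝ) :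
    ∃ S : Finset (ℕ × ℕ), ∀ p ∉ S, B < (dblShift τ σ p).im := by
  obtain ⟨m, hm⟩ := exists_nat_gt (B / τ.im)
  obtain ⟨n, hn⟩ := exists_nat_gt (B / σ.im)
  rw [div_lt_iff₀ hτ] at hm
  rw [div_lt_iff₀ hσ] at hn
  refine ⟨Finset.range m ×ˢ Finset.range n, fun p hp => ?_⟩
  rw [dblShift_im]
  have h1 : 0 ≤ (p.1 : ℝ) * τ.im := by positivity
  have h2 : 0 ≤ (p.2 : ℝ) * σ.im := by positivity
  rw [Finset.mem_product, Finset.mem_range, Finset.mem_range, not_and_or, not_lt, not_lt] at hp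
  rcases hp with hp | hp
  · have : (m : ℝ) * τ.im ≤ p.1 * τ.im := by gcongr
    linarith
  · have : (n : ℝ) * σ.im ≤ p.2 * σ.im := by gcongr
    linarith

/-- Continuation in `η`, to a half plane, of the integrals of `h(t)` against the phase kernel, for
all entire `1`-periodic functions `h` at once. -/
theorem exists_continuation_halfPlane (hτ : 0 < τ.im) (hσ : 0 < σ.im) {M : ℝ} (hM : 0 < M) :
    ∃ (R : ℝ) (J : (ℂ → ℂ) → ℂ → ℂ),
      (∀ h : ℂ → ℂ, Differentiable ℂ h → (∀ z, h (z + 1) = h z) →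
        DifferentiableOn ℂ (J h) (regularSet τ σ ∩ {η | -M < η.im}) ∧
        ∀ η : ℂ, 0 < η.im → J h η = ∫ t in (0 : ℝ)..1, h t * phaseKernel τ σ (2 * η) t) ∧
      (∀ (h : ℂ → ℂ) (c η : ℂ), J (fun t => c * h t) η = c * J h η) ∧
      (∀ η ∈ regularSet τ σ ∩ {η | -M < η.im}, ∃ C : ℝ, 0 ≤ C ∧ ∀ (h : ℂ → ℂ) (B : ℝ),
        (∀ x ∈ Set.Icc (0 : ℝ) 1, ‖h (x + R * I)‖ ≤ B ∧ ‖h (x + -(R * I))‖ ≤ B) →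
        ‖J h η‖ ≤ C * B) := by
  -- For Im η > -M this gives Im(2η) + R > 0, so every a = e(2η + jτ + kσ) satisfies |a e(t)| < 1 on
  -- Im t = R.
  set R : ℝ := 2 * M with hR
  have hR0 : 0 < R := by positivity
  -- The factors outside S do not vanish when |Im t| ≤ R and Im η > -M, so they stay in the
  -- holomorphic part G; only the finitely many in S need splitting.
  obtain ⟨S, hS⟩ := exists_finset_lt_dblShift_im hτ hσ (2 * M + R)
  set W := expProd (dblShift τ σ)
  have hW : Differentiable ℂ W := differentiable_expProd (summable_dblShift hτ hσ)
  set V := expProd fun p : {p // p ∉ S} => dblShift τ σ p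
  have hVs : Summable fun p : {p // p ∉ S} => ‖expTwoPi (dblShift τ σ p)‖ :=
    (summable_dblShift hτ hσ).subtype _
  have hV : Differentiable ℂ V := differentiable_expProd hVs
  have hV0 : ∀ x : ℂ, -(2 * M + R) ≤ x.im → V x ≠ 0 := fun x hx =>
    expProd_ne_zero hVs fun p => by
      rw [add_im]; linarith [hS p p.2]
  set b : ℕ × ℕ → ℂ → ℂ := fun p η => expTwoPi (2 * η + dblShift τ σ p) with hb
  have hbd : ∀ p, Differentiable ℂ (b p) := fun p => by fun_prop
  set G : ℂ × ℂ → ℂ := fun p => W (p.1 - 2 * p.2 + (τ + σ)) * W (-p.1 - 2 * p.2 + (τ + σ)) /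
    (V (p.1 + 2 * p.2) * V (-p.1 + 2 * p.2)) with hG
  have hGden : ∀ (t η : ℂ), -M < η.im → |t.im| ≤ R → V (t + 2 * η) * V (-t + 2 * η) ≠ 0 :=
    fun t η hη ht => by
    rw [abs_le] at ht
    refine mul_ne_zero (hV0 _ ?_) (hV0 _ ?_) <;> simp <;> linarith [ht.1, ht.2]
  have hGa : ∀ (t η : ℂ), -M < η.im → |t.im| ≤ R → AnalyticAt ℂ G (t, η) := fun t η hη ht => by
    have hcomp : ∀ {u : ℂ → ℂ}, Differentiable ℂ u → ∀ {s : ℂ × ℂ → ℂ}, AnalyticAt ℂ s (t, η) →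
      AnalyticAt ℂ (fun p => u (s p)) (t, η) := fun hu s hs => (hu.analyticAt _).fun_comp hs
    have h1 : AnalyticAt ℂ (fun p : ℂ × ℂ => p.1) (t, η) := analyticAt_fst
    have h2 : AnalyticAt ℂ (fun p : ℂ × ℂ => 2 * p.2) (t, η) :=
      analyticAt_const.mul analyticAt_snd
    exact ((hcomp hW ((h1.sub h2).add analyticAt_const)).mul
      (hcomp hW ((h1.neg.sub h2).add analyticAt_const))).div
      ((hcomp hV (h1.add h2)).mul (hcomp hV (h1.neg.add h2))) (hGden t η hη ht)
  set L : List (ℂ → ℂ) := S.toList.map b with hL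
  have hLmem : ∀ a ∈ L, ∃ p, b p = a := fun a ha => by
    obtain ⟨p, -, rfl⟩ := List.mem_map.1 ha
    exact ⟨p, rfl⟩
  have hLprod : ∀ η t : ℂ, listProd (L.map fun a => a η) t =
      ∏ p ∈ S, (1 - expTwoPi (t + 2 * η + dblShift τ σ p)) := fun η t => by
    simp only [listProd, hL, List.map_map]
    rw [← Finset.prod_map_toList]
    congr 2
    funext p
    simp only [hb, Function.comp, ← expTwoPi_add]
    ring_nf
  have hker : ∀ η t : ℂ, phaseKernel τ σ (2 * η) t = G (t, η) /
      (listProd (L.map fun a => a η) t * listProd (L.map fun a => a η) (-t)) := fun η t => by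
    rw [phaseKernel, hLprod, hLprod, expProd_finset_mul_compl (summable_dblShift hτ hσ) S (t + _),
      expProd_finset_mul_compl (summable_dblShift hτ hσ) S (-t + _), div_div]
    congr 1
    ring
  have him : ∀ p, 0 ≤ (dblShift τ σ p).im := fun p => by rw [dblShift_im]; positivity
  have hline : ∀ x : ℝ, |(x + R * I : ℂ).im| ≤ R ∧ |(x + -(R * I) : ℂ).im| ≤ R := fun x => by
    simp [abs_of_pos hR0]
  have hbR : ∀ a ∈ L, ∀ η : ℂ, -M < η.im → ∀ t : ℂ, R ≤ t.im → a η * expTwoPi t ≠ 1 :=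
    fun a ha η hη t ht => by
    obtain ⟨p, rfl⟩ := hLmem a ha
    rw [hb, ← expTwoPi_add]
    refine (sub_ne_zero.1 (one_sub_expTwoPi_ne_zero ?_)).symm
    simp
    linarith [him p]
  have hbR1 : ∀ a ∈ L, ∀ η : ℂ, -M < η.im → ∀ x ∈ Set.Icc (0 : ℝ) 1,
      a η * expTwoPi (x + R * I) ≠ 1 := fun a ha η hη x _ => hbR a ha η hη _ (by simp)
  have hbR2 : ∀ a ∈ L, ∀ η : ℂ, -M < η.im → ∀ x ∈ Set.Icc (0 : ℝ) 1,
      a η * expTwoPi (-(x + -(R * I))) ≠ 1 := fun a ha η hη x _ => hbR a ha η hη _ (by simp)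
  refine ⟨R, fun h η => splitIntegral R (fun t => h t * G (t, η)) (L.map fun a => a η)
    (L.map fun a => a η), fun h hh h1 => ⟨?_, fun η hη => ?_⟩, fun h c η => ?_, fun η hη => ?_⟩
  · have hha : ∀ p : ℂ × ℂ, AnalyticAt ℂ (fun p : ℂ × ℂ => h p.1) p := fun p =>
      (hh.analyticAt _).fun_comp analyticAt_fst
    refine differentiableOn_splitIntegral R (F := fun p => h p.1 * G p)
      ((isOpen_regularSet hτ hσ).inter (isOpen_lt continuous_const Complex.continuous_im))
      (fun x _ η hη => ⟨(hha _).mul (hGa _ _ hη.2 (hline x).1),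
        (hha _).mul (hGa _ _ hη.2 (hline x).2)⟩) L L ?_ ?_ (fun a ha η hη => hbR1 a ha η hη.2)
      (fun a ha η hη => hbR2 a ha η hη.2) ?_
    · intro a ha
      obtain ⟨p, rfl⟩ := hLmem a ha
      exact (hbd p).differentiableOn
    · intro a ha
      obtain ⟨p, rfl⟩ := hLmem a ha
      exact (hbd p).differentiableOn
    · intro a ha a' ha' η hη
      obtain ⟨p, rfl⟩ := hLmem a ha
      obtain ⟨q, rfl⟩ := hLmem a' ha'
      -- Here the polar hyperplanes enter: the product of the factors indexed by p and q is e(4η +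
      -- jτ + kσ) with (j, k) = p + q.
      have := mem_regularSet_iff.1 hη.1 (p.1 + q.1, p.2 + q.2)
      rw [hb, ← expTwoPi_add]
      convert this using 2
      simp only [dblShift]
      push_cast
      ring_nf
  · have hηM : -M < η.im := by linarith
    have hlt : ∀ a ∈ L.map (fun a => a η), ‖a‖ < 1 := fun a ha => by
      obtain ⟨a, ha', rfl⟩ := List.mem_map.1 ha
      obtain ⟨p, rfl⟩ := hLmem a ha'
      exact norm_expTwoPi_lt_one (by simp; linarith [him p])
    refine (splitIntegral_eq hR0.le (fun z => ?_) (fun z hz => ?_) _ _ hlt hlt).trans ?_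
    rotate_right
    · exact intervalIntegral.integral_congr fun t _ => by simp only [hker]; ring
    · have hp : ∀ x, W (x + 1) = W x := expProd_add_one _
      have hq : ∀ x, V (x + 1) = V x := expProd_add_one _
      simp only [hG, h1]
      rw [← hp (-(z + 1) - _ + _), ← hq (-(z + 1) + _), ← hp (z - _ + _), ← hq (z + _)]
      ring_nf
    · exact (hh z).mul (hGa z η hηM hz).curry_left.differentiableAt
  · simp only [mul_assoc]
    exact splitIntegral_const_mul R _ c _ _
  · have hη2 := hη.2
    obtain ⟨C, hC0, hC⟩ := exists_norm_splitIntegral_le R (L.map fun a => a η) (L.map fun a => a η)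
      (fun a ha => by
        obtain ⟨a, ha', rfl⟩ := List.mem_map.1 ha
        exact hbR1 a ha' η hη2)
      (fun a ha => by
        obtain ⟨a, ha', rfl⟩ := List.mem_map.1 ha
        exact hbR2 a ha' η hη2)
    have hGb : ∀ c : ℂ, (∀ x : ℝ, |(x + c : ℂ).im| ≤ R) → ∃ D : ℝ, ∀ x ∈ Set.Icc (0 : ℝ) 1,
        ‖G (x + c, η)‖ ≤ D := fun c hc =>
      isCompact_Icc.exists_bound_of_continuousOn fun x _ =>
        ((hGa _ η hη2 (hc x)).continuousAt.comp (f := fun x : ℝ => ((x + c, η) : ℂ × ℂ))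
          (by fun_prop)).continuousWithinAt
    obtain ⟨D₁, hD₁⟩ := hGb (R * I) fun x => (hline x).1
    obtain ⟨D₂, hD₂⟩ := hGb (-(R * I)) fun x => (hline x).2
    have hD0 : 0 ≤ max D₁ D₂ := (norm_nonneg _).trans ((hD₁ 0 (by simp)).trans (le_max_left _ _))
    refine ⟨C * max D₁ D₂, by positivity, fun h B hB => ?_⟩
    refine (hC _ (max D₁ D₂ * B) fun x hx => ?_).trans_eq (by ring)
    simp only [norm_mul]
    constructor
    · rw [mul_comm]
      exact mul_le_mul ((hD₁ x hx).trans (le_max_left _ _)) (hB x hx).1 (norm_nonneg _) hD0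
    · rw [mul_comm]
      exact mul_le_mul ((hD₂ x hx).trans (le_max_right _ _)) (hB x hx).2 (norm_nonneg _) hD0

/-- Removing a countable set from a half plane leaves a connected set. -/
lemma isPreconnected_halfPlane_inter {s : Set ℂ} (hs : sᶜ.Countable) (M : ℝ) :
    IsPreconnected (s ∩ {z | -M < z.im}) := by
  -- A continuous bijection of the plane onto the half plane, transporting the connectedness of the
  -- complement of a countable set.
  set φ : ℂ → ℂ := fun z => z.re + (Real.exp z.im - M : ℝ) * I with hφ
  have hre : ∀ z, (φ z).re = z.re := fun z => by simp [hφ]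
  have him : ∀ z, (φ z).im = Real.exp z.im - M := fun z => by
    simp only [hφ, add_im, mul_im, ofReal_im, ofReal_re, I_re, I_im]; ring
  have hinj : Function.Injective φ := fun z w h => by
    have h1 := congrArg Complex.re h
    have h2 := congrArg Complex.im h
    rw [hre, hre] at h1
    rw [him, him, sub_left_inj] at h2
    exact Complex.ext h1 (Real.exp_injective h2)
  have himage : s ∩ {z | -M < z.im} = φ '' (φ ⁻¹' sᶜ)ᶜ := by
    rw [← Set.preimage_compl, compl_compl, Set.image_preimage_eq_inter_range]
    congr 1
    ext z
    simp only [Set.mem_ofPred_eq, Set.mem_range]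
    constructor
    · intro hz
      refine ⟨z.re + Real.log (z.im + M) * I, Complex.ext ?_ ?_⟩
      · rw [hre]; simp
      · rw [him, show (z.re + Real.log (z.im + M) * I : ℂ).im = Real.log (z.im + M) by
          simp only [add_im, mul_im, ofReal_im, ofReal_re, I_re, I_im]; ring, Real.exp_log (by linarith)]; ring
    · rintro ⟨w, rfl⟩
      rw [him]
      linarith [Real.exp_pos w.im]
  rw [himage]
  refine (((hs.preimage hinj).isConnected_compl_of_one_lt_rank ?_).isPreconnected).image φ
    (Continuous.continuousOn (by fun_prop))
  rw [Complex.rank_real_complex]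
  norm_num

/-- The identity theorem: the regular part of the half plane is open and connected, and the
functions agree near I. -/
lemma eqOn_halfPlane_of_eqOn_im_pos (hτ : 0 < τ.im) (hσ : 0 < σ.im) {M : ℝ} (hM : 0 < M)
    {f g : ℂ → ℂ} (hf : DifferentiableOn ℂ f (regularSet τ σ ∩ {η | -M < η.im}))
    (hg : DifferentiableOn ℂ g (regularSet τ σ ∩ {η | -M < η.im}))
    (hfg : ∀ η : ℂ, 0 < η.im → f η = g η) :
    Set.EqOn f g (regularSet τ σ ∩ {η | -M < η.im}) := by
  have hU : IsOpen (regularSet τ σ ∩ {η | -M < η.im}) :=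
    (isOpen_regularSet hτ hσ).inter (isOpen_lt continuous_const Complex.continuous_im)
  refine (hf.analyticOnNhd hU).eqOn_of_preconnected_of_eventuallyEq (hg.analyticOnNhd hU)
    (isPreconnected_halfPlane_inter (countable_compl_regularSet hτ hσ) M) (z₀ := I)
    ⟨mem_regularSet_of_im_pos hτ hσ (by simp), by simp; linarith⟩ ?_
  filter_upwards [(isOpen_lt continuous_const Complex.continuous_im).mem_nhds
    (show I ∈ {z : ℂ | 0 < z.im} by simp)] with z hz using hfg z hz

/-- Functions on half planes `Im η > -M` that continue the same function on the upper half plane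
fit together. -/
lemma exists_continuation_of_halfPlanes (hτ : 0 < τ.im) (hσ : 0 < σ.im) {f₀ : ℂ → ℂ}
    (h : ∀ M : ℝ, 0 < M → ∃ f : ℂ → ℂ, DifferentiableOn ℂ f (regularSet τ σ ∩ {η | -M < η.im}) ∧
      ∀ η : ℂ, 0 < η.im → f η = f₀ η) :
    ∃ f : ℂ → ℂ, AnalyticOnNhd ℂ f (regularSet τ σ) ∧ ∀ η : ℂ, 0 < η.im → f η = f₀ η := by
  choose! f hfd hf using h
  have hpos : ∀ η : ℂ, 0 < |η.im| + 1 := fun η => by positivity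
  -- The half plane varies with η; near η₀ all choices agree with the single one for |Im η₀| + 2, by
  -- uniqueness on the smaller half plane.
  refine ⟨fun η => f (|η.im| + 1) η, fun η₀ hη₀ => ?_, fun η hη => hf _ (hpos η) η hη⟩
  set M := |η₀.im| + 2
  have hM : 0 < M := by positivity
  have hlt : ∀ η : ℂ, -(|η.im| + 1) < η.im := fun η => by linarith [neg_abs_le η.im]
  have hU : IsOpen (regularSet τ σ ∩ {η | -M < η.im}) :=
    (isOpen_regularSet hτ hσ).inter (isOpen_lt continuous_const Complex.continuous_im)
  have hη₀U : η₀ ∈ regularSet τ σ ∩ {η | -M < η.im} :=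
    ⟨hη₀, show -(|η₀.im| + 2) < η₀.im by linarith [hlt η₀]⟩
  refine ((hfd M hM).analyticAt (hU.mem_nhds hη₀U)).congr ?_
  have hc : {η : ℂ | |η.im| < |η₀.im| + 1} ∈ nhds η₀ :=
    (isOpen_lt (by fun_prop) continuous_const).mem_nhds (by simp)
  filter_upwards [hU.mem_nhds hη₀U, hc] with η hη hηc
  have hle : |η.im| + 1 ≤ M := by
    have : |η.im| < |η₀.im| + 1 := hηc
    simp only [M]; linarith
  refine eqOn_halfPlane_of_eqOn_im_pos hτ hσ (hpos η) ((hfd M hM).mono ?_) (hfd _ (hpos η))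
    (fun z hz => by rw [hf _ hM z hz, hf _ (hpos η) z hz]) ⟨hη.1, hlt η⟩
  exact fun z hz => ⟨hz.1, show -M < z.im by
    have : -(|η.im| + 1) < z.im := hz.2
    linarith⟩

end

/-! ### The functional representing u and the multipliers of u and Q. -/

section

variable {τ σ : ℂ}

/-- The theta functions in the numerator of the hypergeometric integral. -/
def thetaProd (lam μ τ σ t : ℂ) : ℂ := theta (lam + t) τ * theta (μ + t) σ

lemma differentiable_thetaProd (hτ : 0 < τ.im) (hσ : 0 < σ.im) (lam μ : ℂ) :
    Differentiable ℂ (thetaProd lam μ τ σ) :=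
  ((differentiable_theta hτ).comp (differentiable_id.const_add lam)).mul
    ((differentiable_theta hσ).comp (differentiable_id.const_add μ))

lemma thetaProd_periodic (lam μ τ σ t : ℂ) :
    thetaProd lam μ τ σ (t + 1) = thetaProd lam μ τ σ t := by
  simp only [thetaProd, ← add_assoc, theta_add_one, neg_mul_neg]

lemma differentiableOn_exp_regularSet (lam μ : ℂ) :
    DifferentiableOn ℂ (fun η => cexp (-(Real.pi * I * lam * μ / (2 * η)))) (regularSet τ σ) :=
  fun η hη => by
    have := ne_zero_of_mem_regularSet hη
    have h2 : 2 * η ≠ 0 := mul_ne_zero two_ne_zero this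
    refine DifferentiableAt.differentiableWithinAt ?_
    fun_prop (disch := assumption)

/-- The hypergeometric integral is, on a half plane, given by the continuation of the integral
against the phase kernel. -/
lemma exists_continuation_uIntegral_halfPlane (hτ : 0 < τ.im) (hσ : 0 < σ.im) {M : ℝ}
    (hM : 0 < M) :
    ∃ (R : ℝ) (J : (ℂ → ℂ) → ℂ → ℂ),
      (∀ lam μ : ℂ, DifferentiableOn ℂ
        (fun η => cexp (-(Real.pi * I * lam * μ / (2 * η))) * J (thetaProd lam μ τ σ) η)
        (regularSet τ σ ∩ {η | -M < η.im}) ∧ ∀ η : ℂ, 0 < η.im →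
        cexp (-(Real.pi * I * lam * μ / (2 * η))) * J (thetaProd lam μ τ σ) η =
          uIntegral lam μ τ σ η) ∧
      (∀ (h : ℂ → ℂ) (c η : ℂ), J (fun t => c * h t) η = c * J h η) ∧
      (∀ η ∈ regularSet τ σ ∩ {η | -M < η.im}, ∃ C : ℝ, 0 ≤ C ∧ ∀ (h : ℂ → ℂ) (B : ℝ),
        (∀ x ∈ Set.Icc (0 : ℝ) 1, ‖h (x + R * I)‖ ≤ B ∧ ‖h (x + -(R * I))‖ ≤ B) →
        ‖J h η‖ ≤ C * B) := by
  obtain ⟨C, hC⟩ := exists_uIntegral_eq hτ hσ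
  obtain ⟨R, J, hJ, hlin, hbound⟩ := exists_continuation_halfPlane hτ hσ hM
  refine ⟨R, fun h η => C * J h η, fun lam μ => ⟨?_, fun η hη => ?_⟩, fun h c η => ?_,
    fun η hη => ?_⟩
  · exact ((differentiableOn_exp_regularSet lam μ).mono Set.inter_subset_left).mul
      ((hJ _ (differentiable_thetaProd hτ hσ lam μ)
        (thetaProd_periodic lam μ τ σ)).1.const_mul C)
  · change _ * (C * J _ η) = _
    rw [hC lam μ η hη, (hJ _ (differentiable_thetaProd hτ hσ lam μ)
      (thetaProd_periodic lam μ τ σ)).2 η hη]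
    rfl
  · simp only [hlin]; ring
  · obtain ⟨D, hD0, hD⟩ := hbound η hη
    refine ⟨‖C‖ * D, by positivity, fun h B hB => ?_⟩
    rw [norm_mul, mul_assoc]
    exact mul_le_mul_of_nonneg_left (hD h B hB) (norm_nonneg _)

theorem exists_isContinuation (hτ : 0 < τ.im) (hσ : 0 < σ.im) (lam μ : ℂ) :
    ∃ f : ℂ → ℂ, IsContinuation lam μ τ σ f := by
  refine exists_continuation_of_halfPlanes hτ hσ fun M hM => ?_
  obtain ⟨R, J, hJ, -⟩ := exists_continuation_uIntegral_halfPlane hτ hσ hM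
  exact ⟨_, hJ lam μ⟩

lemma isContinuation_u (hτ : 0 < τ.im) (hσ : 0 < σ.im) (lam μ : ℂ) :
    IsContinuation lam μ τ σ (u lam μ τ σ) :=
  Classical.epsilon_spec (exists_isContinuation hτ hσ lam μ)

/-- At a fixed regular `η`, the functions `u(lam, μ, τ, σ, η)` are given by one homogeneous
functional of `θ(lam + t, τ) θ(μ + t, σ)`, bounded by the values on two horizontal segments. -/
theorem exists_functional (hτ : 0 < τ.im) (hσ : 0 < σ.im) {η : ℂ} (hη : η ∈ regularSet τ σ) :
    ∃ (R C : ℝ) (J : (ℂ → ℂ) → ℂ), 0 ≤ C ∧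
      (∀ lam μ : ℂ, u lam μ τ σ η =
        cexp (-(Real.pi * I * lam * μ / (2 * η))) * J (thetaProd lam μ τ σ)) ∧
      (∀ (h : ℂ → ℂ) (c : ℂ), J (fun t => c * h t) = c * J h) ∧
      (∀ (h : ℂ → ℂ) (B : ℝ),
        (∀ x ∈ Set.Icc (0 : ℝ) 1, ‖h (x + R * I)‖ ≤ B ∧ ‖h (x + -(R * I))‖ ≤ B) →
        ‖J h‖ ≤ C * B) := by
  have hM : 0 < |η.im| + 1 := by positivity
  have hηM : -(|η.im| + 1) < η.im := by linarith [neg_abs_le η.im]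
  obtain ⟨R, J, hJ, hlin, hbound⟩ := exists_continuation_uIntegral_halfPlane hτ hσ hM
  obtain ⟨C, hC0, hC⟩ := hbound η ⟨hη, hηM⟩
  refine ⟨R, C, fun h => J h η, hC0, fun lam μ => ?_, fun h c => hlin h c η, hC⟩
  have hu := isContinuation_u hτ hσ lam μ
  exact eqOn_halfPlane_of_eqOn_im_pos hτ hσ hM
    (hu.1.differentiableOn.mono Set.inter_subset_left) (hJ lam μ).1
    (fun z hz => (hu.2 z hz).trans ((hJ lam μ).2 z hz).symm) ⟨hη, hηM⟩

lemma thetaProd_add_one (lam μ τ σ : ℂ) :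
    thetaProd (lam + 1) μ τ σ = fun t => -1 * thetaProd lam μ τ σ t := by
  funext t
  rw [thetaProd, thetaProd, add_right_comm, theta_add_one]
  ring

/-- The multipliers of the two theta functions depend on t through the same factor e(-t), which
cancels; a shift of λ by τ is thus traded for a shift of μ by σ. -/
lemma thetaProd_add_tau (lam μ τ σ : ℂ) : thetaProd (lam + τ) μ τ σ = fun t =>
    cexp (Real.pi * I * (σ + 2 * μ - τ - 2 * lam)) * thetaProd lam (μ + σ) τ σ t := by
  funext t
  rw [thetaProd, thetaProd, add_right_comm lam, theta_add_tau, add_right_comm μ, theta_add_tau]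
  have : cexp (-(Real.pi * I * (τ + 2 * (lam + t)))) =
      cexp (Real.pi * I * (σ + 2 * μ - τ - 2 * lam)) *
        cexp (-(Real.pi * I * (σ + 2 * (μ + t)))) := by
    rw [← Complex.exp_add]; ring_nf
  rw [this]
  ring

lemma u_add_one (hτ : 0 < τ.im) (hσ : 0 < σ.im) {η : ℂ} (hη : η ∈ regularSet τ σ) (lam μ : ℂ) :
    u (lam + 1) μ τ σ η = -cexp (-(Real.pi * I * μ / (2 * η))) * u lam μ τ σ η := by
  obtain ⟨R, C, J, -, hu, hJ, -⟩ := exists_functional hτ hσ hη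
  rw [hu, hu, thetaProd_add_one, hJ]
  have : cexp (-(Real.pi * I * (lam + 1) * μ / (2 * η))) = cexp (-(Real.pi * I * μ / (2 * η))) *
      cexp (-(Real.pi * I * lam * μ / (2 * η))) := by
    rw [← Complex.exp_add]; ring_nf
  rw [this]
  ring

lemma u_add_tau (hτ : 0 < τ.im) (hσ : 0 < σ.im) {η : ℂ} (hη : η ∈ regularSet τ σ) (lam μ : ℂ) :
    u (lam + τ) μ τ σ η = cexp (Real.pi * I * (σ + 2 * μ - τ - 2 * lam +
      (lam * σ - τ * μ) / (2 * η))) * u lam (μ + σ) τ σ η := by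
  obtain ⟨R, C, J, -, hu, hJ, -⟩ := exists_functional hτ hσ hη
  rw [hu, hu, thetaProd_add_tau, hJ, ← mul_assoc, ← mul_assoc, ← Complex.exp_add,
    ← Complex.exp_add]
  ring_nf

/-- Reindexing the series by an even shift leaves no sign. With σ = -2ηκ, subtracting 2nσ from 2ηj
is the step j → j + 2κn within a residue class. -/
lemma theta_sub_two_mul_intMul (z σ : ℂ) (n : ℤ) : theta (z - 2 * n * σ) σ =
    cexp (Real.pi * I * (4 * n * z - 4 * (n : ℂ) ^ 2 * σ)) * theta z σ := by
  rw [theta, theta, mul_neg, ← tsum_mul_left, ← (Equiv.addRight (2 * n)).tsum_eq]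
  congr 1
  refine tsum_congr fun m => ?_
  have h1 : ∀ w, cexp w = cexp (w + n * (2 * Real.pi * I)) := fun w => by
    rw [Complex.exp_add, exp_int_mul_two_pi_mul_I, mul_one]
  rw [← Complex.exp_add]
  refine Eq.trans ?_ (h1 _).symm
  congr 1
  simp only [Equiv.coe_addRight]
  push_cast
  ring

/-- Only rules for inverses valid at 0 are used, so this holds even where the denominator of Q
vanishes. -/
lemma Q_add_sigma (μ σ η : ℂ) :
    Q (μ + σ) σ η = cexp (Real.pi * I * (2 * σ + 4 * μ)) * Q μ σ η := by
  rw [Q, Q, show μ + σ - 2 * η = μ - 2 * η + σ by ring, show μ + σ + 2 * η = μ + 2 * η + σ by ring,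
    theta_add_tau, theta_add_tau]
  have : cexp (Real.pi * I * (2 * σ + 4 * μ)) =
      (cexp (-(Real.pi * I * (σ + 2 * (μ - 2 * η)))) *
        cexp (-(Real.pi * I * (σ + 2 * (μ + 2 * η)))))⁻¹ := by
    rw [← Complex.exp_add, ← Complex.exp_neg]; ring_nf
  rw [this]
  simp only [div_eq_mul_inv, mul_inv, inv_neg]
  ring

lemma Q_sub_two_mul_intMul (μ σ η : ℂ) (n : ℤ) : Q (μ - 2 * n * σ) σ η =
    cexp (Real.pi * I * (8 * (n : ℂ) ^ 2 * σ - 8 * n * μ)) * Q μ σ η := by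
  rw [Q, Q, show μ - 2 * n * σ - 2 * η = μ - 2 * η - 2 * n * σ by ring,
    show μ - 2 * n * σ + 2 * η = μ + 2 * η - 2 * n * σ by ring,
    theta_sub_two_mul_intMul, theta_sub_two_mul_intMul]
  have : cexp (Real.pi * I * (8 * (n : ℂ) ^ 2 * σ - 8 * n * μ)) =
      (cexp (Real.pi * I * (4 * n * (μ - 2 * η) - 4 * (n : ℂ) ^ 2 * σ)) *
        cexp (Real.pi * I * (4 * n * (μ + 2 * η) - 4 * (n : ℂ) ^ 2 * σ)))⁻¹ := by
    rw [← Complex.exp_add, ← Complex.exp_neg]; ring_nf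
  rw [this]
  simp only [div_eq_mul_inv, mul_inv]
  ring

/-! ### Specialisation to σ = -2ηκ: the summands and their series. -/

section level

variable {κ : ℤ} {η : ℂ}

lemma im_neg_two_mul_pos (hκ : 0 < κ) (hη : η.im < 0) : 0 < (-2 * η * κ).im := by
  have : (0 : ℝ) < κ := by exact_mod_cast hκ
  have h : (-2 * η * κ).im = 2 * (-η.im) * κ := by simp
  rw [h]
  have : 0 < -η.im := by linarith
  positivity

/-- If `j τ + 4 η` is never an integer for `j ≥ 1`, then `η` is not a pole for `σ = -2ηκ`. -/
lemma mem_regularSet_level (hκ : 3 ≤ κ) (hτ : 0 < τ.im) (hη : η.im < 0)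
    (hreg : ∀ j : ℕ, 1 ≤ j → ∀ n : ℤ, (j : ℂ) * τ + 4 * η ≠ n) :
    η ∈ regularSet τ (-2 * η * κ) := by
  intro l m n h
  have hκ' : (3 : ℝ) ≤ κ := by exact_mod_cast hκ
  have him := congrArg Complex.im h
  simp at him
  rcases Nat.eq_zero_or_pos n with rfl | hn
  · rcases Nat.eq_zero_or_pos m with rfl | hm
    · simp at him
      linarith
    · refine hreg m hm (-l) ?_
      push_cast at h ⊢
      linear_combination h
  · have hn' : (1 : ℝ) ≤ n := by exact_mod_cast hn
    have h1 : 0 ≤ (m : ℝ) * τ.im := by positivity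
    -- The coefficient 4 - 2nκ of Im η is then negative, so the sum has positive imaginary part and
    -- cannot vanish.
    have h2 : 3 ≤ (n : ℝ) * κ := by nlinarith
    nlinarith

lemma summand_add_one (hκ : 0 < κ) (hτ : 0 < τ.im) (hη : η.im < 0)
    (hreg : η ∈ regularSet τ (-2 * η * κ)) (lam : ℂ) (j : ℤ) :
    summand κ (lam + 1) τ η j = (-1) ^ (j + 1) * summand κ lam τ η j := by
  have hη0 := ne_zero_of_mem_regularSet hreg
  rw [summand, summand, u_add_one hτ (im_neg_two_mul_pos hκ hη) hreg]
  have : cexp (-(Real.pi * I * (2 * η * j) / (2 * η))) = (-1) ^ j := by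
    rw [← exp_neg_pi_mul_I, ← Complex.exp_int_mul]
    congr 1
    field_simp
  rw [this, zpow_add₀ (by norm_num), zpow_one]
  ring

/-- Replacing j by j - κ in the Gaussian produces terms linear in j that exactly absorb those of the
multipliers of u and Q; the prefactor is what is left. -/
lemma summand_add_tau (hκ : 0 < κ) (hτ : 0 < τ.im) (hη : η.im < 0)
    (hreg : η ∈ regularSet τ (-2 * η * κ)) (lam : ℂ) (j : ℤ) :
    cexp (Real.pi * I * (κ + 2) * (lam + τ / 2)) * summand κ (lam + τ) τ η j =
      summand κ lam τ η (j - κ) := by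
  have hη0 := ne_zero_of_mem_regularSet hreg
  have hκ0 : (κ : ℂ) ≠ 0 := by exact_mod_cast hκ.ne'
  have e : 2 * η * ((j - κ : ℤ) : ℂ) = 2 * η * j + -2 * η * κ := by push_cast; ring
  rw [summand, summand, u_add_tau hτ (im_neg_two_mul_pos hκ hη) hreg, e, Q_add_sigma]
  set U := u lam (2 * η * j + -2 * η * κ) τ (-2 * η * κ) η
  set q := Q (2 * η * j) (-2 * η * κ) η
  have : ∀ a b c d e : ℂ, a + b + c = d + e → cexp a * (cexp b * U * q * cexp c) =
      U * (cexp d * q) * cexp e := fun a b c d e h => by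
    have h' := congrArg cexp h
    simp only [Complex.exp_add] at h'
    linear_combination U * q * h'
  apply this
  push_cast
  field_simp
  ring

/-- For j = 2κn + l, the terms in σn² from theta, Q and the Gaussian have coefficients -4, 8 and -4
and cancel. The remaining quadratic exponent is 2κτn², which beats the exponential growth of the
functional. -/
lemma summable_summand (hκ : 0 < κ) (hτ : 0 < τ.im) (hη : η.im < 0)
    (hreg : η ∈ regularSet τ (-2 * η * κ)) (lam : ℂ) (l : ℤ) :
    Summable fun n : ℤ => summand κ lam τ η (2 * κ * n + l) := by
  have hη0 := ne_zero_of_mem_regularSet hreg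
  have hκ0 : (κ : ℂ) ≠ 0 := by exact_mod_cast hκ.ne'
  have hκR : (0 : ℝ) < κ := by exact_mod_cast hκ
  have hσ := im_neg_two_mul_pos hκ hη
  set σ := -2 * η * κ with hσdef
  obtain ⟨R, C, J, hC, hu, hJ, hb⟩ := exists_functional hτ hσ hreg
  set g := thetaProd lam (2 * η * l) τ σ with hg
  have hgc : Continuous g := (differentiable_thetaProd hτ hσ _ _).continuous
  obtain ⟨B₁, hB₁⟩ := isCompact_Icc.exists_bound_of_continuousOn (s := Set.Icc (0 : ℝ) 1)
    (f := fun x : ℝ => g (x + R * I)) (by fun_prop)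
  obtain ⟨B₂, hB₂⟩ := isCompact_Icc.exists_bound_of_continuousOn (s := Set.Icc (0 : ℝ) 1)
    (f := fun x : ℝ => g (x + -(R * I))) (by fun_prop)
  -- Shifting the argument of theta by -2nσ multiplies the integrand by e(2nt), of size at most
  -- exp(4π|R||n|) on the two segments.
  have hJn : ∀ n : ℤ, ‖J fun t => expTwoPi (2 * n * t) * g t‖ ≤
      C * (Real.exp (4 * Real.pi * |R| * |(n : ℝ)|) * max B₁ B₂) := fun n => by
    have hexp : ∀ y : ℝ, |y| = |R| → ∀ x : ℝ, ‖expTwoPi (2 * n * (x + y * I))‖ ≤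
        Real.exp (4 * Real.pi * |R| * |(n : ℝ)|) := fun y hy x => by
      rw [norm_expTwoPi]
      refine Real.exp_le_exp.2 ?_
      have h1 : (2 * n * (x + y * I) : ℂ).im = 2 * (n * y) := by simp; ring
      have h2 : -(n * y) ≤ |(n : ℝ)| * |R| := by
        rw [← hy, ← abs_mul]; exact neg_le_abs _
      rw [h1]
      nlinarith [Real.pi_pos]
    refine hb _ _ fun x hx => ?_
    rw [norm_mul, norm_mul]
    constructor
    · exact mul_le_mul (hexp R rfl x) ((hB₁ x hx).trans (le_max_left _ _)) (norm_nonneg _)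
        (Real.exp_pos _).le
    · have := hexp (-R) (abs_neg R) x
      rw [ofReal_neg, neg_mul] at this
      exact mul_le_mul this ((hB₂ x hx).trans (le_max_right _ _)) (norm_nonneg _)
        (Real.exp_pos _).le
  set β : ℂ := 2 * τ * l - 2 * κ * lam
  set δ : ℂ := (τ + 4 * η) * (l : ℂ) ^ 2 / (2 * κ) - lam * l
  set q := Q (2 * η * l) σ η
  have hs : ∀ n : ℤ, summand κ lam τ η (2 * κ * n + l) =
      cexp (Real.pi * I * (2 * κ * τ * (n : ℂ) ^ 2 + β * n + δ)) * q *
        J fun t => expTwoPi (2 * n * t) * g t := fun n => by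
    have e : 2 * η * ((2 * κ * n + l : ℤ) : ℂ) = 2 * η * l - 2 * n * σ := by
      rw [hσdef]; push_cast; ring
    have hθ : thetaProd lam (2 * η * l - 2 * n * σ) τ σ = fun t =>
        cexp (Real.pi * I * (4 * n * (2 * η * l) - 4 * (n : ℂ) ^ 2 * σ)) *
          (expTwoPi (2 * n * t) * g t) := by
      funext t
      rw [hg, thetaProd, thetaProd, sub_add_eq_add_sub, theta_sub_two_mul_intMul, expTwoPi]
      have : cexp (Real.pi * I * (4 * n * (2 * η * l + t) - 4 * (n : ℂ) ^ 2 * σ)) =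
          cexp (Real.pi * I * (4 * n * (2 * η * l) - 4 * (n : ℂ) ^ 2 * σ)) *
            cexp (2 * Real.pi * I * (2 * n * t)) := by
        rw [← Complex.exp_add]; ring_nf
      rw [this]
      ring
    rw [summand, ← hσdef, e, hu, hθ, hJ, Q_sub_two_mul_intMul]
    set Jn := J fun t => expTwoPi (2 * n * t) * g t
    have : ∀ a b c d e : ℂ, a + b + c + d = e → cexp a * (cexp b * Jn) * (cexp c * q) * cexp d =
        cexp e * q * Jn := fun a b c d e h => by
      rw [← h]
      simp only [Complex.exp_add]
      ring
    apply this
    simp only [β, δ, hσdef]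
    push_cast
    field_simp
    ring
  -- Chosen so that 2πS|n| covers the linear exponent π|Im β||n| and the growth 4π|R||n| of the
  -- functional.
  set S : ℝ := |β.im| / 2 + 2 * |R|
  have hT : 0 < 2 * κ * τ.im := by positivity
  have hsum := (summable_pow_mul_jacobiTheta₂_term_bound S hT 0).mul_left
    (Real.exp (-Real.pi * δ.im) * ‖q‖ * C * max B₁ B₂)
  refine Summable.of_norm_bounded hsum fun n => ?_
  rw [hs n, norm_mul, norm_mul]
  have hn : ‖cexp (Real.pi * I * (2 * κ * τ * (n : ℂ) ^ 2 + β * n + δ))‖ =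
      Real.exp (-Real.pi * (2 * κ * τ.im * (n : ℝ) ^ 2 + β.im * n + δ.im)) := by
    have hre : ∀ w : ℂ, (Real.pi * I * w).re = -Real.pi * w.im := fun w => by simp
    rw [Complex.norm_exp, hre]
    congr 2
    have : (2 * κ * τ * (n : ℂ) ^ 2 + β * n + δ) =
        ((2 * κ * (n : ℝ) ^ 2 : ℝ) : ℂ) * τ + β * ((n : ℝ) : ℂ) + δ := by push_cast; ring
    rw [this, add_im, add_im, im_ofReal_mul, im_mul_ofReal]
    ring
  have hB0 : 0 ≤ max B₁ B₂ := (norm_nonneg _).trans ((hB₁ 0 (by simp)).trans (le_max_left _ _))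
  have hfin : Real.exp (-Real.pi * (2 * κ * τ.im * (n : ℝ) ^ 2 + β.im * n + δ.im)) *
      Real.exp (4 * Real.pi * |R| * |(n : ℝ)|) ≤ Real.exp (-Real.pi * δ.im) *
        Real.exp (-Real.pi * (2 * κ * τ.im * n ^ 2 - 2 * S * |n|)) := by
    rw [← Real.exp_add, ← Real.exp_add, Real.exp_le_exp]
    have h1 : -(β.im * n) ≤ |β.im| * |(n : ℝ)| := by rw [← abs_mul]; exact neg_le_abs _
    have h2 := mul_le_mul_of_nonneg_left h1 Real.pi_pos.le
    simp only [S]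
    push_cast
    linarith
  calc _ ≤ Real.exp (-Real.pi * (2 * κ * τ.im * (n : ℝ) ^ 2 + β.im * n + δ.im)) * ‖q‖ *
        (C * (Real.exp (4 * Real.pi * |R| * |(n : ℝ)|) * max B₁ B₂)) := by
        rw [hn]; gcongr; exact hJn n
    _ = ‖q‖ * C * max B₁ B₂ *
        (Real.exp (-Real.pi * (2 * κ * τ.im * (n : ℝ) ^ 2 + β.im * n + δ.im)) *
          Real.exp (4 * Real.pi * |R| * |(n : ℝ)|)) := by ring
    _ ≤ ‖q‖ * C * max B₁ B₂ * (Real.exp (-Real.pi * δ.im) *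
        Real.exp (-Real.pi * (2 * κ * τ.im * n ^ 2 - 2 * S * |n|))) := by gcongr
    _ = _ := by rw [pow_zero]; ring

lemma DeltaTilde_add_one (hκ : 0 < κ) (hτ : 0 < τ.im) (hη : η.im < 0)
    (hreg : η ∈ regularSet τ (-2 * η * κ)) (lam : ℂ) (l : ℤ) :
    DeltaTilde l κ (lam + 1) τ η = (-1) ^ (l + 1) * DeltaTilde l κ lam τ η := by
  rw [DeltaTilde, DeltaTilde, ← tsum_mul_left]
  refine tsum_congr fun n => ?_
  rw [summand_add_one hκ hτ hη hreg]
  congr 1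
  rw [add_assoc, zpow_add₀ (by norm_num), mul_assoc, Even.neg_one_zpow (even_two_mul _), one_mul]

lemma DeltaTilde_add_tau (hκ : 0 < κ) (hτ : 0 < τ.im) (hη : η.im < 0)
    (hreg : η ∈ regularSet τ (-2 * η * κ)) (lam : ℂ) (l : ℤ) :
    cexp (Real.pi * I * (κ + 2) * (lam + τ / 2)) * DeltaTilde l κ (lam + τ) τ η =
      DeltaTilde (l + κ) κ lam τ η := by
  -- The summands move to the class of l - κ; one step in n turns this into l + κ modulo 2κ.
  rw [DeltaTilde, DeltaTilde, ← tsum_mul_left, ← (Equiv.addRight (1 : ℤ)).tsum_eq]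
  refine tsum_congr fun n => ?_
  rw [summand_add_tau hκ hτ hη hreg]
  congr 1
  simp only [Equiv.coe_addRight]
  ring

lemma DeltaTilde_add_two_mul (l κ : ℤ) (lam τ η : ℂ) :
    DeltaTilde (l + κ + κ) κ lam τ η = DeltaTilde l κ lam τ η := by
  rw [DeltaTilde, DeltaTilde, ← (Equiv.addRight (1 : ℤ)).tsum_eq fun n : ℤ =>
    summand κ lam τ η (2 * κ * n + l)]
  refine tsum_congr fun n => ?_
  congr 1
  simp only [Equiv.coe_addRight]
  ring

end level

end

end HypergeometricTheta

end

/-! ### The theorem: antisymmetrising in λ. -/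

theorem theorem4p2 (κ : ℤ) (hκ : 4 ≤ κ) (τ η : ℂ) (hτ : 0 < τ.im) (hη : η.im < 0)
    (hreg : ∀ j : ℕ, 1 ≤ j → ∀ n : ℤ, (j : ℂ) * τ + 4 * η ≠ n)
    (l : ℤ) (hl : HypergeometricTheta.Admissible κ l) :
    -- the functions in the identities are well defined
    (∀ lam μ : ℂ, ∃ f : ℂ → ℂ,
      HypergeometricTheta.IsContinuation lam μ τ (-2 * η * κ) f) ∧
    (∀ lam : ℂ, Summable fun n : ℤ =>
      HypergeometricTheta.summand κ lam τ η (2 * κ * n + l)) ∧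
    -- the two identities
    (∀ lam : ℂ, HypergeometricTheta.Delta l κ (lam + 1) τ η =
      (-1) ^ (l + 1) * HypergeometricTheta.Delta l κ lam τ η) ∧
    (∀ lam : ℂ,
      Complex.exp (Real.pi * Complex.I * (κ + 2) * (lam + τ / 2)) *
          HypergeometricTheta.Delta l κ (lam + τ) τ η =
        HypergeometricTheta.Delta (l + κ) κ lam τ η) := by
  have hκ0 : 0 < κ := by linarith
  have hr := HypergeometricTheta.mem_regularSet_level (by linarith) hτ hη hreg
  refine ⟨HypergeometricTheta.exists_isContinuation hτ
      (HypergeometricTheta.im_neg_two_mul_pos hκ0 hη),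
    fun lam => HypergeometricTheta.summable_summand hκ0 hτ hη hr lam l, fun lam => ?_,
    fun lam => ?_⟩
  · have h1 := HypergeometricTheta.DeltaTilde_add_one hκ0 hτ hη hr lam l
    -- The reflected term moves by -1, so the relation is used backwards; its sign is its own
    -- inverse.
    have h2 := HypergeometricTheta.DeltaTilde_add_one hκ0 hτ hη hr (-(lam + 1)) l
    rw [neg_add, neg_add_cancel_right] at h2
    have h3 : ((-1 : ℂ) ^ (l + 1)) * (-1) ^ (l + 1) = 1 := by
      rw [← mul_zpow]; simp
    rw [HypergeometricTheta.Delta, HypergeometricTheta.Delta, h1, neg_add, h2]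
    linear_combination HypergeometricTheta.DeltaTilde l κ (-lam + -1) τ η * h3
  · have h1 := HypergeometricTheta.DeltaTilde_add_tau hκ0 hτ hη hr lam l
    -- For the reflected term, starting from index l + κ lands on l + 2κ, which is the same series
    -- as l; the prefactor at -(λ + τ) is inverse to the one at λ.
    have h2 := HypergeometricTheta.DeltaTilde_add_tau hκ0 hτ hη hr (-(lam + τ)) (l + κ)
    rw [HypergeometricTheta.DeltaTilde_add_two_mul, neg_add, neg_add_cancel_right] at h2
    have h3 : Complex.exp (Real.pi * Complex.I * (κ + 2) * (lam + τ / 2)) *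
        Complex.exp (Real.pi * Complex.I * (κ + 2) * (-lam + -τ + τ / 2)) = 1 := by
      rw [← Complex.exp_add, ← Complex.exp_zero]; ring_nf
    rw [HypergeometricTheta.Delta, HypergeometricTheta.Delta, neg_add]
    linear_combination h1 + Complex.exp (Real.pi * Complex.I * (κ + 2) * (lam + τ / 2)) * h2 -
      HypergeometricTheta.DeltaTilde (l + κ) κ (-lam) τ η * h3
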